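/- Theorem (enumeration of the $20V_3$ model). For $m\ge 1$ let $\mathcal T_m$ be the set of points $(x,y)\in\mathbb Z^2$ with $x\le 0$, $y\le m-1$, $x+y\ge 0$ (the lattice points of the triangle with corners $(0,0)$, $(1-m,m-1)$, $(0,m-1)$), viewed in the triangular lattice on $\mathbb Z^2$ in which every vertex $p$ is joined to $p\pm(1,0)$, $p\pm(1,-1)$ and $p\pm(0,1)$. A configuration of the $20V_3$ model on $\mathcal T_m$ is a choice of orientation of every edge of the triangular lattice having at least one end in $\mathcal T_m$, such that each vertex of $\mathcal T_m$ has exactly three incoming and three outgoing edges (the ice rule) and the external edges (those with exactly one end in $\mathcal T_m$) satisfy the following domain-wall type boundary conditions: the North external edges (the edges from the vertices of the row $y=m-1$ to $p+(0,1)$ and $p+(-1,1)$) point out of $\mathcal T_m$; the East external edges (the edges from the vertices of the column $x=0$ to $p+(1,0)$ and $p+(1,-1)$) point into $\mathcal T_m$; at each vertex $p=(-y,y)$ of the diagonal side, the two external edges to $p-(1,0)$ and $p-(0,1)$ both point into $\mathcal T_m$ if $2y>m-1$ and both point out of $\mathcal T_m$ if $2y<m-1$, while if $2y=m-1$ (the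 center vertex, for odd $m$) the edge to $p-(1,0)$ points in and the edge to $p-(0,1)$ points out. Let $Z_m^{20V_3}$ be the number of these configurations. Let $Z_n^{6V}$ be the partition function of the six-vertex model with domain-wall boundary conditions on the $n\times n$ square grid with uniform weights $(a,b,c)=(1,\sqrt2,1)$, i.e. the sum, over all orientations of the edges of the grid (external edges included) with two incoming and two outgoing edges at each vertex, all horizontal external edges pointing in and all vertical external edges pointing out, of the product over the vertices of their weights. Here a vertex has weight $c$ if its two horizontal edges have opposite orientations (one pointing left and the other right); otherwise both lines pass straight through it, and it has weight $a$ if the directions of its horizontal and vertical lines are (right, down) or (left, up), and $b$ if they are (right, up) or (left, down). Then for every $n\ge 1$, $$Z_{2n}^{20V_3}=2^{n(n+1)/2}\,Z_n^{6V},\qquad Z_{2n-1}^{20V_3}=2^{n(n-1)/2}\,Z_n^{6V}.$$ -/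

import Mathlib

/-! ### The triangular lattice on `ℤ × ℤ` -/

/-- The three families of lines of the triangular lattice. -/
inductive LineType where
  | horizontal
  | diagonal
  | vertical
  deriving DecidableEq

instance : Fintype LineType where
  elems := {.horizontal, .diagonal, .vertical}
  complete := by intro ℓ; cases ℓ <;> simp

/-- The lattice step along each line: right, down-right, down. -/
def LineType.step : LineType → ℤ × ℤ
  | .horizontal => (1, 0)
  | .diagonal => (1, -1)
  | .vertical => (0, -1)

/-- The edge `(ℓ, p)` of the triangular lattice joins the vertex `p` to the vertex `p + ℓ.step`. -/
abbrev TriEdge := LineType × (ℤ × ℤ)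

/-- The left (for vertical edges: upper) end of an edge. -/
def TriEdge.start (e : TriEdge) : ℤ × ℤ := e.2

/-- The right (for vertical edges: lower) end of an edge. -/
def TriEdge.finish (e : TriEdge) : ℤ × ℤ := e.2 + e.1.step

/-! ### The triangle `T_m` and its edges -/

/-- The vertices of the triangle of size `m`: the lattice points of the triangle with extremal
vertices `(0, 0)`, `(1 - m, m - 1)`, `(0, m - 1)`. -/
noncomputable def triangle (m : ℕ) : Finset (ℤ × ℤ) :=
  (Finset.Icc (1 - (m : ℤ)) 0 ×ˢ Finset.Icc 0 ((m : ℤ) - 1)).filter fun p => 0 ≤ p.1 + p.2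

/-- All edges of the triangular lattice having at least one end in the triangle of size `m`:
the inner edges, and the external edges that cross the boundary. -/
noncomputable def triEdges (m : ℕ) : Finset TriEdge :=
  (Finset.univ : Finset LineType).biUnion fun ℓ =>
    (triangle m).image (fun p => (ℓ, p)) ∪ (triangle m).image (fun p => (ℓ, p - ℓ.step))

/-- An orientation of these edges: `true` is the orientation from `start` to `finish`
(right, down-right or down), `false` the opposite one (left, up-left or up). -/
abbrev TriOrientation (m : ℕ) := triEdges m → Bool

/-- The vertex towards which the edge `e` is oriented. -/
def TriOrientation.head {m : ℕ} (σ : TriOrientation m) (e : triEdges m) : ℤ × ℤ :=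
  if σ e then TriEdge.finish e else TriEdge.start e

/-- The vertex away from which the edge `e` is oriented. -/
def TriOrientation.tail {m : ℕ} (σ : TriOrientation m) (e : triEdges m) : ℤ × ℤ :=
  if σ e then TriEdge.start e else TriEdge.finish e

/-- The ice rule: each vertex of the triangle has exactly three incoming and exactly three
outgoing edges. -/
def TriOrientation.IceRule {m : ℕ} (σ : TriOrientation m) : Prop :=
  ∀ p ∈ triangle m,
    (Finset.univ.filter fun e => σ.head e = p).card = 3 ∧
    (Finset.univ.filter fun e => σ.tail e = p).card = 3

/-- An external edge is oriented into the triangle. -/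
def TriOrientation.PointsIn {m : ℕ} (σ : TriOrientation m) (e : triEdges m) : Prop :=
  σ.tail e ∉ triangle m ∧ σ.head e ∈ triangle m

/-- An external edge is oriented out of the triangle. -/
def TriOrientation.PointsOut {m : ℕ} (σ : TriOrientation m) (e : triEdges m) : Prop :=
  σ.tail e ∈ triangle m ∧ σ.head e ∉ triangle m

/-- The domain-wall boundary conditions of the 20V₃ model.

* The North external edges (vertical or diagonal) start in the row `y = m` just above the triangle.
* The East external edges (horizontal or diagonal) finish in the column `x = 1` just to the right
  of the triangle.
* The external edges across the diagonal side `x + y = 0` are, at each vertex `(-y, y)` of that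
  side, the West one, which starts at `(-y - 1, y)`, and the South one, which finishes at
  `(-y, y - 1)`, both on the line `x + y = -1`. The vertex is in the top half if `2y > m - 1`, in
  the bottom half if `2y < m - 1`, and it is the center vertex (`m` odd) if `2y = m - 1`. -/
structure TriOrientation.DWBC3 {m : ℕ} (σ : TriOrientation m) : Prop where
  north : ∀ e : triEdges m, (TriEdge.start e).2 = m → σ.PointsOut e
  east : ∀ e : triEdges m, (TriEdge.finish e).1 = 1 → σ.PointsIn e
  top_half_west : ∀ e : triEdges m, (TriEdge.start e).1 + (TriEdge.start e).2 = -1 →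
    2 * (TriEdge.finish e).2 > (m : ℤ) - 1 → σ.PointsIn e
  top_half_south : ∀ e : triEdges m, (TriEdge.finish e).1 + (TriEdge.finish e).2 = -1 →
    2 * (TriEdge.start e).2 > (m : ℤ) - 1 → σ.PointsIn e
  bottom_half_west : ∀ e : triEdges m, (TriEdge.start e).1 + (TriEdge.start e).2 = -1 →
    2 * (TriEdge.finish e).2 < (m : ℤ) - 1 → σ.PointsOut e
  bottom_half_south : ∀ e : triEdges m, (TriEdge.finish e).1 + (TriEdge.finish e).2 = -1 →
    2 * (TriEdge.start e).2 < (m : ℤ) - 1 → σ.PointsOut e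
  center_west : ∀ e : triEdges m, (TriEdge.start e).1 + (TriEdge.start e).2 = -1 →
    2 * (TriEdge.finish e).2 = (m : ℤ) - 1 → σ.PointsIn e
  center_south : ∀ e : triEdges m, (TriEdge.finish e).1 + (TriEdge.finish e).2 = -1 →
    2 * (TriEdge.start e).2 = (m : ℤ) - 1 → σ.PointsOut e

/-- The number of configurations of the 20V₃ model on the triangle of size `m`. -/
noncomputable def numConfigurations20V3 (m : ℕ) : ℕ :=
  Nat.card {σ : TriOrientation m // σ.IceRule ∧ σ.DWBC3}

/-! ### The six vertex model on the `n × n` grid -/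

/-- An orientation of the edges of the `n × n` grid, external edges included. Rows are numbered
from top to bottom and columns from left to right. `hor i j` is the `j`-th horizontal edge of
row `i` from the left (`true`: oriented to the right); `ver i j` is the `i`-th vertical edge of
column `j` from the top (`true`: oriented downwards). -/
structure SquareOrientation (n : ℕ) where
  hor : Fin n → Fin (n + 1) → Bool
  ver : Fin (n + 1) → Fin n → Bool
  deriving Fintype

namespace SquareOrientation

variable {n : ℕ}

/-- The edge on the left of the vertex in row `i` and column `j`. -/
def west (τ : SquareOrientation n) (i j : Fin n) : Bool := τ.hor i j.castSucc

/-- The edge on the right of the vertex in row `i` and column `j`. -/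
def east (τ : SquareOrientation n) (i j : Fin n) : Bool := τ.hor i j.succ

/-- The edge above the vertex in row `i` and column `j`. -/
def north (τ : SquareOrientation n) (i j : Fin n) : Bool := τ.ver i.castSucc j

/-- The edge below the vertex in row `i` and column `j`. -/
def south (τ : SquareOrientation n) (i j : Fin n) : Bool := τ.ver i.succ j

/-- The ice rule: each vertex has two incoming (hence two outgoing) edges. -/
def IceRule (τ : SquareOrientation n) : Prop :=
  ∀ i j : Fin n,
    (τ.west i j).toNat + (!τ.east i j).toNat + (τ.north i j).toNat + (!τ.south i j).toNat = 2

/-- Domain wall boundary conditions: the horizontal external edges point into the grid and the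
vertical external edges point out of it. -/
def DWBC (τ : SquareOrientation n) : Prop :=
  (∀ i, τ.hor i 0 = true ∧ τ.hor i (Fin.last n) = false) ∧
  (∀ j, τ.ver 0 j = false ∧ τ.ver (Fin.last n) j = true)

/-- The weight of a vertex obeying the ice rule: `c` if its two horizontal edges have opposite
orientations (and then so do the vertical ones); otherwise both lines go straight through the
vertex, and the weight is `a` for the directions left-up and right-down, and `b` for the directions
right-up and left-down. -/
def vertexWeight (a b c : ℝ) (τ : SquareOrientation n) (i j : Fin n) : ℝ :=
  if τ.west i j = τ.east i j then
    if τ.west i j = τ.north i j then a else b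
  else c

end SquareOrientation

open Classical in
/-- The partition function of the 6V model with DWBC on the `n × n` grid, with uniform vertex
weights `(a, b, c)`. -/
noncomputable def partition6VDWBC (a b c : ℝ) (n : ℕ) : ℝ :=
  ∑ τ ∈ Finset.univ.filter (fun τ : SquareOrientation n => τ.IceRule ∧ τ.DWBC),
    ∏ i : Fin n, ∏ j : Fin n, τ.vertexWeight a b c i j

/-! The model is read as an operator. Every lattice line carries a bit and is travelled to the
right, to the lower right or upwards; every vertex is a `gate` replacing the bits of the lines
through it. Gates act on functions of the final bits, so in a composition the outermost gate meets
the initial bits first. The number of configurations is the composition of all vertex gates, applied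
to the indicator of vanishing final bits and evaluated at `boundaryBits`
(`numConfigurations20V3_eq_gates`, an instance of `LineNetwork.gates_eq_sum`).

The weights of the twenty vertex model, all equal to 1, factorise into three six vertex crossings
(`gate_twentyWeight`), which displaces each diagonal line slightly to the North-East of the grid
vertices it met. The Yang-Baxter equation (`crossing_yangBaxter`) pushes it further, one diagonal of
grid vertices at a time. Both ends of a diagonal line carry the bit `false`, and so do the North and
East ends of the grid lines; hence the two extreme crossings of the diagonal line are frozen with
weight 1 at every stage, and it disappears at the right-angled corner
(`sweepAbove_gates_trianglePoints`). Removing all diagonals leaves the six vertex model with weights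
`(1, √2, 1)` on the triangle.

There, a vertex whose row and column start with different bits is crossed straight by both lines,
with weight `√2` (`gates_gridWeight_filter`). These vertices fill the two acute corners of the
triangle. What remains is an `n × n` square with domain-wall boundary conditions, and the `m(m+1)/2
- n²` frozen vertices produce the power of 2. -/

/-! ### Gates acting on functions of a bit assignment -/

section Gates

variable {ι L L' : Type*}

theorem extend_comp_of_disjoint {i : L → ι} {j : L' → ι} (h : ∀ a b, i a ≠ j b)
    (b : L → Bool) (x : ι → Bool) : Function.extend i b x ∘ j = x ∘ j := by
  funext k
  exact Function.extend_apply' _ _ _ (by rintro ⟨a, ha⟩; exact h a k ha)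

theorem extend_extend_comm {i : L → ι} {j : L' → ι} (h : ∀ a b, i a ≠ j b)
    (b : L → Bool) (c : L' → Bool) (x : ι → Bool) :
    Function.extend i b (Function.extend j c x) = Function.extend j c (Function.extend i b x) := by
  classical
  funext k
  by_cases h1 : ∃ a, i a = k
  · have h2 : ¬ ∃ a, j a = k := by
      rintro ⟨a', ha'⟩; obtain ⟨a, ha⟩ := h1; exact h a a' (ha.trans ha'.symm)
    rw [Function.extend_apply' _ _ _ h2]
    simp only [Function.extend_def, h1, dif_pos]
  · rw [Function.extend_apply' _ _ _ h1]
    simp only [Function.extend_def, h1, dif_neg, not_false_iff]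

variable [Fintype L] [DecidableEq L] [Fintype L'] [DecidableEq L']

/-- The operator that replaces the bits on the lines `i` by all possible new bits, with
weight `w old new`. -/
noncomputable def gate (w : (L → Bool) → (L → Bool) → ℝ) (i : L → ι) (f : (ι → Bool) → ℝ)
    (x : ι → Bool) : ℝ :=
  ∑ b : L → Bool, w (x ∘ i) b * f (Function.extend i b x)

/-- Each gate reads and overwrites only its own bits. All reorderings of crossings that share no
line rest on this. -/
theorem gate_comm (w : (L → Bool) → (L → Bool) → ℝ) (w' : (L' → Bool) → (L' → Bool) → ℝ)
    {i : L → ι} {j : L' → ι} (h : ∀ a b, i a ≠ j b) (f : (ι → Bool) → ℝ) :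
    gate w i (gate w' j f) = gate w' j (gate w i f) := by
  funext x
  simp only [gate, Finset.mul_sum]
  rw [Finset.sum_comm]
  refine Finset.sum_congr rfl fun c _ => Finset.sum_congr rfl fun b _ => ?_
  rw [extend_comp_of_disjoint h, extend_comp_of_disjoint (fun a b => (h b a).symm),
    extend_extend_comm h]
  ring

/-- `f` vanishes when the bit on the line `k` is `true`. -/
def SupportedOff (k : ι) (f : (ι → Bool) → ℝ) : Prop := ∀ x, x k = true → f x = 0

theorem SupportedOff.gate {k : ι} {f : (ι → Bool) → ℝ} (hf : SupportedOff k f)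
    (w : (L → Bool) → (L → Bool) → ℝ) {i : L → ι} (hi : ∀ a, i a ≠ k) :
    SupportedOff k (gate w i f) := by
  intro x hx
  refine Finset.sum_eq_zero fun b _ => ?_
  rw [hf, mul_zero]
  rwa [Function.extend_apply' _ _ _ (by rintro ⟨a, ha⟩; exact hi a ha)]

/-- If `f` and `g` agree on all assignments satisfying `p`, which does not depend on the lines `i`,
then so do their images under a gate on `i`. -/
theorem gate_congr_on {p : (ι → Bool) → Prop} (w : (L → Bool) → (L → Bool) → ℝ) {i : L → ι}
    (hp : ∀ x b, p x → p (Function.extend i b x)) {f g : (ι → Bool) → ℝ}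
    (h : ∀ x, p x → f x = g x) (x : ι → Bool) (hx : p x) : gate w i f x = gate w i g x :=
  Finset.sum_congr rfl fun b _ => by rw [h _ (hp x b hx)]

theorem sum_fin_two_arrow (F : (Fin 2 → Bool) → ℝ) :
    ∑ b : Fin 2 → Bool, F b = ∑ a : Bool, ∑ b : Bool, F ![a, b] := by
  rw [← Fintype.sum_prod_type']
  exact Fintype.sum_equiv (finTwoArrowEquiv Bool) _ _ fun b => by
    congr 1; funext k; fin_cases k <;> rfl

theorem extend_pair [DecidableEq ι] {i j : ι} (hij : i ≠ j) (a b : Bool) (x : ι → Bool) :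
    Function.extend ![i, j] ![a, b] x = Function.update (Function.update x i a) j b := by
  have hinj : Function.Injective ![i, j] := by
    intro k l; fin_cases k <;> fin_cases l <;> simp [hij, hij.symm]
  funext k
  by_cases hj : k = j
  · subst hj
    simpa using hinj.extend_apply ![a, b] x 1
  by_cases hi : k = i
  · subst hi
    simpa [hij] using hinj.extend_apply ![a, b] x 0
  · rw [Function.extend_apply']
    · simp [hi, hj]
    · rintro ⟨l, hl⟩
      fin_cases l
      · exact hi hl.symm
      · exact hj hl.symm

/-- A gate on two lines. -/
noncomputable def gate2 (w : Bool → Bool → Bool → Bool → ℝ) (i j : ι) :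
    ((ι → Bool) → ℝ) → (ι → Bool) → ℝ :=
  gate (fun a b => w (a 0) (a 1) (b 0) (b 1)) ![i, j]

theorem gate2_apply [DecidableEq ι] (w : Bool → Bool → Bool → Bool → ℝ) {i j : ι} (hij : i ≠ j)
    (f : (ι → Bool) → ℝ) (x : ι → Bool) :
    gate2 w i j f x =
      ∑ a, ∑ b, w (x i) (x j) a b * f (Function.update (Function.update x i a) j b) := by
  simp only [gate2, gate, sum_fin_two_arrow, extend_pair hij]
  rfl

/-- Bits attached to the three types of lines. -/
def lineBits (a b c : Bool) : LineType → Bool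
  | .horizontal => a
  | .vertical => b
  | .diagonal => c

theorem sum_lineType_arrow (F : (LineType → Bool) → ℝ) :
    ∑ b : LineType → Bool, F b = ∑ a : Bool, ∑ b : Bool, ∑ c : Bool, F (lineBits a b c) := by
  simp_rw [← Fintype.sum_prod_type']
  refine Fintype.sum_equiv
    { toFun := fun b => (b .horizontal, b .vertical, b .diagonal)
      invFun := fun q => lineBits q.1 q.2.1 q.2.2
      left_inv := fun b => by funext ℓ; cases ℓ <;> rfl
      right_inv := fun q => rfl } _ _ fun b => ?_
  congr 1; funext ℓ; cases ℓ <;> rfl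

end Gates

/-! ### The vertex weights and the Yang-Baxter equation -/

/-- Six vertex weights in terms of the West, South, East and North edges. -/
noncomputable def sixWeight (a b c : ℝ) (w s e n : Bool) : ℝ :=
  if w.toNat + n.toNat = e.toNat + s.toNat then
    if w = e then if w = n then a else b else c
  else 0

/-- The weights of the twenty vertex model in terms of the incoming and outgoing bits. -/
def twentyWeight (a b : LineType → Bool) : ℝ :=
  if (a .horizontal).toNat + (a .diagonal).toNat + (b .vertical).toNat =
    (b .horizontal).toNat + (b .diagonal).toNat + (a .vertical).toNat then 1 else 0

section YangBaxter

variable {ι : Type*}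

/-- The crossing of a horizontal line `h` and a vertical line `v`. -/
noncomputable def crossHV (h v : ι) : ((ι → Bool) → ℝ) → (ι → Bool) → ℝ :=
  gate2 (sixWeight 1 (Real.sqrt 2) 1) h v

/-- The crossing of a diagonal line `d` and a vertical line `v`. -/
noncomputable def crossDV (d v : ι) : ((ι → Bool) → ℝ) → (ι → Bool) → ℝ :=
  gate2 (sixWeight 1 (Real.sqrt 2 / 2) (Real.sqrt 2 / 2)) d v

/-- The crossing of a diagonal line `d` and a horizontal line `h`. -/
noncomputable def crossDH (d h : ι) : ((ι → Bool) → ℝ) → (ι → Bool) → ℝ :=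
  gate2 (fun d w d' e => sixWeight 1 (Real.sqrt 2 / 2) (Real.sqrt 2 / 2) d e d' w) d h

variable [DecidableEq ι] {i : LineType → ι}

theorem extend_lineType (hi : Function.Injective i) (b : LineType → Bool) (x : ι → Bool) :
    Function.extend i b x = Function.update (Function.update (Function.update x (i .horizontal)
      (b .horizontal)) (i .vertical) (b .vertical)) (i .diagonal) (b .diagonal) := by
  funext k
  by_cases hk : ∃ ℓ, i ℓ = k
  · obtain ⟨ℓ, rfl⟩ := hk
    rw [hi.extend_apply]
    cases ℓ <;> simp [hi.eq_iff]
  · rw [Function.extend_apply' _ _ _ hk]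
    push Not at hk
    simp [(hk _).symm]

theorem crossHV_extend (hi : Function.Injective i) (f : (ι → Bool) → ℝ) (x : ι → Bool)
    (a b c : Bool) : crossHV (i .horizontal) (i .vertical) f (Function.extend i (lineBits a b c) x) =
      ∑ a', ∑ b', sixWeight 1 (Real.sqrt 2) 1 a b a' b' *
        f (Function.extend i (lineBits a' b' c) x) := by
  rw [crossHV, gate2_apply _ (by simp [hi.eq_iff])]
  refine Finset.sum_congr rfl fun a' _ => Finset.sum_congr rfl fun b' _ => ?_
  rw [hi.extend_apply, hi.extend_apply]
  congr 2
  rw [extend_lineType hi, extend_lineType hi]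
  funext k
  simp only [Function.update_apply, lineBits]
  split_ifs <;> simp_all [hi.eq_iff]

theorem crossDV_extend (hi : Function.Injective i) (f : (ι → Bool) → ℝ) (x : ι → Bool)
    (a b c : Bool) : crossDV (i .diagonal) (i .vertical) f (Function.extend i (lineBits a b c) x) =
      ∑ c', ∑ b', sixWeight 1 (Real.sqrt 2 / 2) (Real.sqrt 2 / 2) c b c' b' *
        f (Function.extend i (lineBits a b' c') x) := by
  rw [crossDV, gate2_apply _ (by simp [hi.eq_iff])]
  refine Finset.sum_congr rfl fun a' _ => Finset.sum_congr rfl fun b' _ => ?_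
  rw [hi.extend_apply, hi.extend_apply]
  congr 2
  rw [extend_lineType hi, extend_lineType hi]
  funext k
  simp only [Function.update_apply, lineBits]
  split_ifs <;> simp_all [hi.eq_iff]

theorem crossDH_extend (hi : Function.Injective i) (f : (ι → Bool) → ℝ) (x : ι → Bool)
    (a b c : Bool) : crossDH (i .diagonal) (i .horizontal) f
      (Function.extend i (lineBits a b c) x) =
      ∑ c', ∑ a', sixWeight 1 (Real.sqrt 2 / 2) (Real.sqrt 2 / 2) c a' c' a *
        f (Function.extend i (lineBits a' b c') x) := by
  rw [crossDH, gate2_apply _ (by simp [hi.eq_iff])]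
  refine Finset.sum_congr rfl fun a' _ => Finset.sum_congr rfl fun b' _ => ?_
  rw [hi.extend_apply, hi.extend_apply]
  congr 2
  rw [extend_lineType hi, extend_lineType hi]
  funext k
  simp only [Function.update_apply, lineBits]
  split_ifs <;> simp_all [hi.eq_iff]

theorem exists_eq_extend_lineBits (hi : Function.Injective i) (x : ι → Bool) :
    ∃ a b c, x = Function.extend i (lineBits a b c) x := by
  refine ⟨x (i .horizontal), x (i .vertical), x (i .diagonal), ?_⟩
  rw [extend_lineType hi]
  simp [lineBits]

theorem gate_twentyWeight_extend (hi : Function.Injective i) (f : (ι → Bool) → ℝ) (x : ι → Bool)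
    (a b c : Bool) : gate twentyWeight i f (Function.extend i (lineBits a b c) x) =
      ∑ a', ∑ b', ∑ c', twentyWeight (lineBits a b c) (lineBits a' b' c') *
        f (Function.extend i (lineBits a' b' c') x) := by
  rw [gate, sum_lineType_arrow]
  refine Finset.sum_congr rfl fun a' _ => Finset.sum_congr rfl fun b' _ =>
    Finset.sum_congr rfl fun c' _ => ?_
  rw [show Function.extend i (lineBits a b c) x ∘ i = lineBits a b c from
    funext fun ℓ => hi.extend_apply _ _ _]
  congr 2
  rw [extend_lineType hi, extend_lineType hi, extend_lineType hi]
  funext k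
  simp only [Function.update_apply, lineBits]
  split_ifs <;> rfl

/-- The twenty vertex weights factorise into three six vertex crossings, the diagonal line passing
on the North-East side of the crossing of the other two. -/
theorem gate_twentyWeight (hi : Function.Injective i) (f : (ι → Bool) → ℝ) :
    gate twentyWeight i f = crossHV (i .horizontal) (i .vertical)
      (crossDV (i .diagonal) (i .vertical) (crossDH (i .diagonal) (i .horizontal) f)) := by
  funext x
  obtain ⟨a, b, c, hx⟩ := exists_eq_extend_lineBits hi x
  rw [hx]
  have h2 : Real.sqrt 2 ^ 2 = 2 := Real.sq_sqrt (by norm_num)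
  simp only [crossHV_extend hi, crossDV_extend hi, crossDH_extend hi, gate_twentyWeight_extend hi,
    Fintype.sum_bool]
  -- For each of the eight inputs both sides are linear in the values of `f` at the outputs. The
  -- weights are such that the products over the three crossings, summed over the inner edges, give
  -- 1 for every admissible output; only `√2 ^ 2 = 2` is needed.
  cases a <;> cases b <;> cases c <;>
    simp [sixWeight, twentyWeight, lineBits] <;> ring_nf <;> simp only [h2] <;> ring

/-- The Yang-Baxter equation. -/
theorem crossing_yangBaxter (hi : Function.Injective i) (f : (ι → Bool) → ℝ) :
    crossDH (i .diagonal) (i .horizontal) (crossDV (i .diagonal) (i .vertical)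
        (crossHV (i .horizontal) (i .vertical) f)) =
      crossHV (i .horizontal) (i .vertical) (crossDV (i .diagonal) (i .vertical)
        (crossDH (i .diagonal) (i .horizontal) f)) := by
  funext x
  obtain ⟨a, b, c, hx⟩ := exists_eq_extend_lineBits hi x
  rw [hx]
  have h2 : Real.sqrt 2 ^ 2 = 2 := Real.sq_sqrt (by norm_num)
  simp only [crossHV_extend hi, crossDV_extend hi, crossDH_extend hi, Fintype.sum_bool]
  cases a <;> cases b <;> cases c <;>
    simp [sixWeight] <;> ring_nf <;> simp only [h2] <;> ring

/-- When the outgoing bit of `v` and the incoming bit of `d` are `false`, conservation forces the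
other two bits to be `false`, and the vertex has weight `a = 1`. -/
theorem crossDV_eq_of_supportedOff {d v : ι} (hdv : d ≠ v) {f : (ι → Bool) → ℝ}
    (hf : SupportedOff v f) (x : ι → Bool) (hx : x d = false) : crossDV d v f x = f x := by
  rw [crossDV, gate2_apply _ hdv]
  simp only [Fintype.sum_bool]
  rw [hf (Function.update _ v true) (by simp), hf (Function.update _ v true) (by simp)]
  cases hv : x v
  · have : Function.update (Function.update x d false) v false = x := by
      funext k; simp only [Function.update_apply]; split_ifs <;> simp_all
    simp [sixWeight, this, hx]
  · simp [sixWeight, hx, hf x hv]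

/-- Here both frozen bits are outgoing, so conservation determines the incoming ones and no
condition on the input is needed. -/
theorem crossDH_eq_of_supportedOff {d h : ι} (hdh : d ≠ h) {f : (ι → Bool) → ℝ}
    (hd : SupportedOff d f) (hh : SupportedOff h f) : crossDH d h f = f := by
  funext x
  rw [crossDH, gate2_apply _ hdh]
  simp only [Fintype.sum_bool]
  rw [hh (Function.update _ h true) (by simp), hh (Function.update _ h true) (by simp),
    hd (Function.update (Function.update x d true) h false) (by simp [hdh])]
  cases hx : x h
  · cases hx' : x d
    · have : Function.update (Function.update x d false) h false = x := by
        funext k; simp only [Function.update_apply]; split_ifs <;> simp_all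
      simp [sixWeight, this]
    · simp [sixWeight, hd x hx']
  · cases hx' : x d <;> simp [sixWeight, hh x hx]

end YangBaxter

/-! ### Moving the diagonal lines out of the triangle -/

/-- The lines of the triangular lattice. -/
abbrev TriLine := LineType × ℤ

/-- The position of the line of type `ℓ` through a point among all lines of type `ℓ`. -/
def LineType.coord : LineType → ℤ × ℤ → ℤ
  | .horizontal, p => p.2
  | .diagonal, p => p.1 + p.2
  | .vertical, p => p.1

/-- The line of type `ℓ` through the point `p`. -/
def lineThrough (p : ℤ × ℤ) (ℓ : LineType) : TriLine := (ℓ, ℓ.coord p)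

theorem lineThrough_injective (p : ℤ × ℤ) : Function.Injective (lineThrough p) :=
  fun _ _ h => congrArg Prod.fst h

/-- The horizontal and the vertical line through a point. -/
def gridLines (p : ℤ × ℤ) : Fin 2 → TriLine :=
  ![lineThrough p .horizontal, lineThrough p .vertical]

/-- The composition of the gates at the points of a list, the first point acting first. -/
noncomputable def gates {ι P L : Type*} [Fintype L] [DecidableEq L]
    (w : (L → Bool) → (L → Bool) → ℝ) (line : P → L → ι) (l : List P) (f : (ι → Bool) → ℝ) :
    (ι → Bool) → ℝ :=
  l.foldr (fun p => gate w (line p)) f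

/-- The six vertex weight `(1, √2, 1)` in the form used by `gate`. -/
noncomputable def gridWeight (a b : Fin 2 → Bool) : ℝ :=
  sixWeight 1 (Real.sqrt 2) 1 (a 0) (a 1) (b 0) (b 1)

/-- A diagonal line `d` passing from upper left to lower right just above the points of `l`. -/
noncomputable def sweepAbove (d : TriLine) (l : List (ℤ × ℤ)) (f : (TriLine → Bool) → ℝ) :
    (TriLine → Bool) → ℝ :=
  l.foldr (fun p g => crossDV d (lineThrough p .vertical)
    (crossDH d (lineThrough p .horizontal) g)) f

/-- A diagonal line `d` passing from upper left to lower right just below the points of `l`. -/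
noncomputable def sweepBelow (d : TriLine) (l : List (ℤ × ℤ)) (f : (TriLine → Bool) → ℝ) :
    (TriLine → Bool) → ℝ :=
  l.foldr (fun p g => crossDH d (lineThrough p .horizontal)
    (crossDV d (lineThrough p .vertical) g)) f

/-- The points `(x, y), (x + 1, y - 1), …` (`k` of them). -/
def diagonalPoints : ℤ → ℤ → ℕ → List (ℤ × ℤ)
  | _, _, 0 => []
  | x, y, k + 1 => (x, y) :: diagonalPoints (x + 1) (y - 1) k

theorem mem_diagonalPoints {x y : ℤ} {k : ℕ} {p : ℤ × ℤ} :
    p ∈ diagonalPoints x y k ↔ x ≤ p.1 ∧ p.1 < x + k ∧ p.1 + p.2 = x + y := by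
  induction k generalizing x y with
  | zero => simp only [diagonalPoints, List.not_mem_nil, Nat.cast_zero, false_iff]; omega
  | succ k ih =>
    rw [diagonalPoints, List.mem_cons, ih, Prod.ext_iff]
    push_cast
    omega

theorem gridLines_ne_of_ne {p q : ℤ × ℤ} (h1 : p.1 ≠ q.1) (h2 : p.2 ≠ q.2) (a b : Fin 2) :
    gridLines p a ≠ gridLines q b := by
  fin_cases a <;> fin_cases b <;> simp [gridLines, lineThrough, LineType.coord, h1, h2]

theorem crossHV_eq_gate (p : ℤ × ℤ) :
    crossHV (lineThrough p .horizontal) (lineThrough p .vertical) =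
      gate gridWeight (gridLines p) := rfl

theorem gates_gate2_comm (w : Bool → Bool → Bool → Bool → ℝ) {i j : TriLine}
    {l : List (ℤ × ℤ)} (hi : ∀ p ∈ l, ∀ a, gridLines p a ≠ i)
    (hj : ∀ p ∈ l, ∀ a, gridLines p a ≠ j) (f : (TriLine → Bool) → ℝ) :
    gate2 w i j (gates gridWeight gridLines l f) = gates gridWeight gridLines l (gate2 w i j f) := by
  induction l with
  | nil => rfl
  | cons p l ih =>
    have := ih (fun q hq => hi q (by simp [hq])) (fun q hq => hj q (by simp [hq]))
    simp only [gates, List.foldr_cons] at this ⊢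
    rw [← this, gate2, gate_comm]
    intro a b
    fin_cases a
    · exact (hi p (by simp) b).symm
    · exact (hj p (by simp) b).symm

theorem gridLines_ne_diagonal (p : ℤ × ℤ) (a : Fin 2) (d : ℤ) : gridLines p a ≠ (.diagonal, d) := by
  fin_cases a <;> simp [gridLines, lineThrough]

theorem gridLines_ne_lineThrough {p q : ℤ × ℤ} (h1 : p.1 ≠ q.1) (h2 : p.2 ≠ q.2) (a : Fin 2)
    {ℓ : LineType} (hℓ : ℓ ≠ .diagonal) : gridLines p a ≠ lineThrough q ℓ := by
  cases ℓ
  · exact gridLines_ne_of_ne h1 h2 a 0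
  · exact absurd rfl hℓ
  · exact gridLines_ne_of_ne h1 h2 a 1

/-- Resolving the vertices of a diagonal line pushes it to its North-East side. -/
theorem gates_twentyWeight_diagonalPoints (x y : ℤ) (k : ℕ) (f : (TriLine → Bool) → ℝ) :
    gates twentyWeight lineThrough (diagonalPoints x y k) f =
      gates gridWeight gridLines (diagonalPoints x y k)
        (sweepAbove (.diagonal, x + y) (diagonalPoints x y k) f) := by
  induction k generalizing x y with
  | zero => rfl
  | succ k ih =>
    have ih' := ih (x + 1) (y - 1)
    have hq : ∀ p ∈ diagonalPoints (x + 1) (y - 1) k, p.1 ≠ x ∧ p.2 ≠ y := by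
      intro p hp; rw [mem_diagonalPoints] at hp; omega
    rw [show x + 1 + (y - 1) = x + y by ring] at ih'
    simp only [diagonalPoints, gates, sweepAbove, List.foldr_cons] at ih' ⊢
    rw [ih', gate_twentyWeight (lineThrough_injective _), ← crossHV_eq_gate]
    congr 1
    -- The grid vertices further along the diagonal lie in other rows and columns, so the crossings
    -- of the diagonal line near `(x, y)` can be postponed until after all of them.
    have key := fun (w) (ℓ : LineType) (hℓ : ℓ ≠ .diagonal) (g) => gates_gate2_comm w
      (i := (.diagonal, x + y)) (j := lineThrough (x, y) ℓ)
      (l := diagonalPoints (x + 1) (y - 1) k) (fun p _ a => gridLines_ne_diagonal p a _)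
      (fun p hp a => gridLines_ne_lineThrough (hq p hp).1 (hq p hp).2 a hℓ) g
    simp only [gates] at key
    rw [show lineThrough (x, y) .diagonal = (.diagonal, x + y) from rfl, crossDH, crossDV,
      key _ _ (by simp), key _ _ (by simp)]

/-- A diagonal line moves through the vertices of the next diagonal. -/
theorem sweepBelow_gates (d x y : ℤ) (k : ℕ) (f : (TriLine → Bool) → ℝ) :
    sweepBelow (.diagonal, d) (diagonalPoints x y k)
        (gates gridWeight gridLines (diagonalPoints x y k) f) =
      gates gridWeight gridLines (diagonalPoints x y k)
        (sweepAbove (.diagonal, d) (diagonalPoints x y k) f) := by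
  induction k generalizing x y f with
  | zero => rfl
  | succ k ih =>
    have hq : ∀ p ∈ diagonalPoints (x + 1) (y - 1) k, p.1 ≠ x ∧ p.2 ≠ y := by
      intro p hp; rw [mem_diagonalPoints] at hp; omega
    have ih' := ih (x + 1) (y - 1) f
    have key := fun (w) (ℓ : LineType) (hℓ : ℓ ≠ .diagonal) (g) => gates_gate2_comm w
      (i := (.diagonal, d)) (j := lineThrough (x, y) ℓ)
      (l := diagonalPoints (x + 1) (y - 1) k) (fun p _ a => gridLines_ne_diagonal p a _)
      (fun p hp a => gridLines_ne_lineThrough (hq p hp).1 (hq p hp).2 a hℓ) g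
    -- For the same reason the grid vertex `(x, y)` can be moved in front of the rest of the sweep,
    -- next to the two crossings with which it forms a Yang-Baxter triangle.
    have hsw : ∀ (l : List (ℤ × ℤ)) (g), (∀ p ∈ l, p.1 ≠ x ∧ p.2 ≠ y) →
        sweepBelow (.diagonal, d) l (gate gridWeight (gridLines (x, y)) g) =
        gate gridWeight (gridLines (x, y)) (sweepBelow (.diagonal, d) l g) := by
      intro l g hl
      induction l with
      | nil => rfl
      | cons q l ih =>
        have hcomm : ∀ (w) (ℓ : LineType) (_ : ℓ ≠ .diagonal) (g),
            gate2 w (.diagonal, d) (lineThrough q ℓ) (gate gridWeight (gridLines (x, y)) g) =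
            gate gridWeight (gridLines (x, y)) (gate2 w (.diagonal, d) (lineThrough q ℓ) g) := by
          intro w ℓ hℓ g
          refine gate_comm _ _ (fun a b => ?_) g
          fin_cases a
          · exact (gridLines_ne_diagonal _ b d).symm
          · exact (gridLines_ne_lineThrough (hl q (by simp)).1.symm (hl q (by simp)).2.symm b hℓ).symm
        have := ih (fun p hp => hl p (by simp [hp]))
        simp only [sweepBelow, List.foldr_cons] at this ⊢
        rw [this, crossDH, crossDV, hcomm _ _ (by simp), hcomm _ _ (by simp)]
    -- The moving line has left its original position, so `d` need not be the diagonal through `(x,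
    -- y)` and `lineThrough` cannot be used.
    have hybe := crossing_yangBaxter (ι := TriLine) (i := fun ℓ => match ℓ with
      | .diagonal => (.diagonal, d)
      | .horizontal => lineThrough (x, y) .horizontal
      | .vertical => lineThrough (x, y) .vertical)
      (fun a b h => by cases a <;> cases b <;> simp_all [lineThrough])
    have hsw' := hsw _ (gates gridWeight gridLines (diagonalPoints (x + 1) (y - 1) k) f) hq
    simp only [diagonalPoints, gates, sweepAbove, sweepBelow, List.foldr_cons] at ih' hsw' key ⊢
    rw [hsw', ih', ← crossHV_eq_gate, hybe]
    congr 1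
    rw [crossDH, crossDV, key _ _ (by simp), key _ _ (by simp)]

/-- The line `d` meets columns and rows alternately. Pairing these crossings with a shift by one
isolates the first column and the last row, and the rest is a passage just below the next diagonal.
-/
theorem sweepAbove_diagonalPoints_succ (d : TriLine) (x y : ℤ) (k : ℕ)
    (f : (TriLine → Bool) → ℝ) :
    sweepAbove d (diagonalPoints x y (k + 1)) f =
      crossDV d (.vertical, x) (sweepBelow d (diagonalPoints (x + 1) y k)
        (crossDH d (.horizontal, y - k) f)) := by
  induction k generalizing x y with
  | zero => simp [sweepAbove, sweepBelow, diagonalPoints, lineThrough, LineType.coord]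
  | succ k ih =>
    have h1 : sweepAbove d (diagonalPoints x y (k + 1 + 1)) f =
        crossDV d (.vertical, x) (crossDH d (.horizontal, y)
          (sweepAbove d (diagonalPoints (x + 1) (y - 1) (k + 1)) f)) := rfl
    have h2 : ∀ g, sweepBelow d (diagonalPoints (x + 1) y (k + 1)) g =
        crossDH d (.horizontal, y) (crossDV d (.vertical, x + 1)
          (sweepBelow d (diagonalPoints (x + 1 + 1) (y - 1) k) g)) := fun _ => rfl
    rw [h1, h2, ih]
    congr 6
    push_cast
    ring

/-- The points of the triangle of size `k` with right angle at `(0, M)`, diagonal by diagonal from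
the South-West to the North-East. -/
def trianglePoints (M : ℤ) : ℕ → List (ℤ × ℤ)
  | 0 => []
  | k + 1 => diagonalPoints (-k) M (k + 1) ++ trianglePoints M k

theorem mem_trianglePoints {M : ℤ} {k : ℕ} {p : ℤ × ℤ} :
    p ∈ trianglePoints M k ↔ p.1 ≤ 0 ∧ p.2 ≤ M ∧ M - k < p.1 + p.2 := by
  induction k with
  | zero => simp only [trianglePoints, List.not_mem_nil, false_iff]; push_cast; omega
  | succ k ih =>
    rw [trianglePoints, List.mem_append, ih, mem_diagonalPoints]
    push_cast
    omega

open Classical in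
/-- The indicator function of all bits of the lines in `R` being `false`. -/
noncomputable def allFalse {ι : Type*} (R : Set ι) (x : ι → Bool) : ℝ :=
  if ∀ k ∈ R, x k = false then 1 else 0

theorem supportedOff_allFalse {ι : Type*} {R : Set ι} {k : ι} (hk : k ∈ R) :
    SupportedOff k (allFalse R) := by
  intro x hx
  rw [allFalse, if_neg]
  intro h
  simp [h k hk] at hx

theorem SupportedOff.gates {k : TriLine} {f : (TriLine → Bool) → ℝ} (hf : SupportedOff k f)
    {l : List (ℤ × ℤ)} (h : ∀ p ∈ l, ∀ a, gridLines p a ≠ k) :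
    SupportedOff k (gates gridWeight gridLines l f) := by
  induction l with
  | nil => exact hf
  | cons p l ih => exact (ih fun q hq => h q (by simp [hq])).gate _ (h p (by simp))

theorem gates_append {ι P L : Type*} [Fintype L] [DecidableEq L]
    (w : (L → Bool) → (L → Bool) → ℝ) (line : P → L → ι) (l l' : List P) (f : (ι → Bool) → ℝ) :
    gates w line (l ++ l') f = gates w line l (gates w line l' f) := by
  simp [gates]

theorem SupportedOff.sweepBelow {k d : TriLine} {f : (TriLine → Bool) → ℝ} (hf : SupportedOff k f)
    {l : List (ℤ × ℤ)} (hd : d ≠ k) (h : ∀ p ∈ l, ∀ ℓ, lineThrough p ℓ ≠ k) :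
    SupportedOff k (sweepBelow d l f) := by
  induction l with
  | nil => exact hf
  | cons p l ih =>
    have := ih fun q hq => h q (by simp [hq])
    have hg : ∀ ℓ (a : Fin 2), ![d, lineThrough p ℓ] a ≠ k := fun ℓ a => by
      fin_cases a
      exacts [hd, h p (by simp) ℓ]
    simp only [_root_.sweepBelow, List.foldr_cons, crossDH, crossDV, gate2] at this ⊢
    exact (this.gate _ (hg _)).gate _ (hg _)

theorem gates_congr_on {ι P L : Type*} [Fintype L] [DecidableEq L] {p : (ι → Bool) → Prop}
    (w : (L → Bool) → (L → Bool) → ℝ) (line : P → L → ι) (l : List P)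
    (hp : ∀ q ∈ l, ∀ x b, p x → p (Function.extend (line q) b x)) {f g : (ι → Bool) → ℝ}
    (h : ∀ x, p x → f x = g x) (x : ι → Bool) (hx : p x) :
    gates w line l f x = gates w line l g x := by
  induction l generalizing x with
  | nil => exact h x hx
  | cons q l ih =>
    exact gate_congr_on w (hp q (by simp)) (fun y hy => ih (fun r hr => hp r (by simp [hr])) y hy)
      x hx

/-- A diagonal line all of whose ends are frozen passes freely through the six vertex model on a
triangle. -/
theorem sweepAbove_gates_trianglePoints (M d : ℤ) (k : ℕ) {R : Set TriLine}
    (hd : (.diagonal, d) ∈ R) (hv : ∀ j : ℤ, -k ≤ j → j ≤ 0 → (.vertical, j) ∈ R)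
    (hh : ∀ j : ℤ, M - k ≤ j → j ≤ M → (.horizontal, j) ∈ R) (x : TriLine → Bool)
    (hx : x (.diagonal, d) = false) :
    sweepAbove (.diagonal, d) (diagonalPoints (-k) M (k + 1))
      (gates gridWeight gridLines (trianglePoints M k) (allFalse R)) x =
    gates gridWeight gridLines (trianglePoints M k) (allFalse R) x := by
  set F := gates gridWeight gridLines (trianglePoints M k) (allFalse R) with hF
  have hne : ∀ p ∈ trianglePoints M k, ∀ a, gridLines p a ≠ (.diagonal, d) ∧
      gridLines p a ≠ (.horizontal, M - k) ∧ gridLines p a ≠ (.vertical, -(k : ℤ)) := by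
    intro p hp a
    rw [mem_trianglePoints] at hp
    refine ⟨gridLines_ne_diagonal _ _ _, ?_, ?_⟩ <;> fin_cases a <;>
      simp [gridLines, lineThrough, LineType.coord] <;> omega
  have hFd : SupportedOff (.diagonal, d) F :=
    (supportedOff_allFalse hd).gates fun p hp a => (hne p hp a).1
  have hFh : SupportedOff (.horizontal, M - k) F :=
    (supportedOff_allFalse (hh _ le_rfl (by omega))).gates fun p hp a => (hne p hp a).2.1
  have hFv : SupportedOff (.vertical, -(k : ℤ)) F :=
    (supportedOff_allFalse (hv _ le_rfl (by omega))).gates fun p hp a => (hne p hp a).2.2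
  -- No vertex of the remaining triangle lies in the row `M - k` or the column `-k`, so the final
  -- bits of these lines are already frozen at the two extreme crossings, which can be dropped.
  rw [sweepAbove_diagonalPoints_succ, crossDH_eq_of_supportedOff (by simp) hFd hFh,
    crossDV_eq_of_supportedOff (by simp) _ _ hx]
  · cases k with
    | zero => rfl
    | succ k =>
      have e : -((k + 1 : ℕ) : ℤ) + 1 = -k := by push_cast; ring
      -- Yang-Baxter carries the line across the outermost diagonal of the remaining triangle; what
      -- is left is the same statement for a smaller one.
      rw [hF, trianglePoints, gates_append, e, sweepBelow_gates]
      refine gates_congr_on (p := fun x => x (.diagonal, d) = false) _ _ _ ?_ ?_ _ hx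
      · intro q _ x b hx
        rwa [Function.extend_apply' _ _ _ (by rintro ⟨a, ha⟩; exact gridLines_ne_diagonal _ _ _ ha)]
      · intro x hx
        exact sweepAbove_gates_trianglePoints M d k hd (fun j h1 h2 => hv j (by push_cast; omega) h2)
          (fun j h1 h2 => hh j (by push_cast; omega) h2) x hx
  · refine hFv.sweepBelow (by simp) fun p hp ℓ => ?_
    rw [mem_diagonalPoints] at hp
    cases ℓ <;> simp [lineThrough, LineType.coord]
    omega

/-- The twenty vertex model on a triangle, with all outgoing bits and all bits of the diagonal
lines frozen, reduces to the six vertex model. -/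
theorem gates_twentyWeight_trianglePoints (M : ℤ) (k : ℕ) {R : Set TriLine}
    (hd : ∀ j : ℤ, M - k < j → j ≤ M → (.diagonal, j) ∈ R)
    (hv : ∀ j : ℤ, -k < j → j ≤ 0 → (.vertical, j) ∈ R)
    (hh : ∀ j : ℤ, M - k < j → j ≤ M → (.horizontal, j) ∈ R) (x : TriLine → Bool)
    (hx : ∀ j : ℤ, M - k < j → j ≤ M → x (.diagonal, j) = false) :
    gates twentyWeight lineThrough (trianglePoints M k) (allFalse R) x =
      gates gridWeight gridLines (trianglePoints M k) (allFalse R) x := by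
  induction k generalizing x with
  | zero => rfl
  | succ k ih =>
    push_cast at hd hv hh hx
    have ih' := ih (fun j _ _ => hd j (by omega) (by omega)) (fun j _ _ => hv j (by omega) (by omega))
      (fun j _ _ => hh j (by omega) (by omega))
    rw [trianglePoints, gates_append, gates_append]
    -- The inner triangle is reduced first: the vertices of the outermost diagonal do not touch the
    -- inner diagonal lines, whose bits are still `false` when the inner triangle is reached.
    have h1 := gates_congr_on (p := fun x => ∀ j : ℤ, M - k < j → j ≤ M → x (.diagonal, j) = false)
      twentyWeight lineThrough (diagonalPoints (-k) M (k + 1)) (fun q hq x b hx j h1 h2 => by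
        rw [mem_diagonalPoints] at hq
        rw [Function.extend_apply', hx j h1 h2]
        rintro ⟨ℓ, hℓ⟩
        cases ℓ <;> simp [lineThrough, LineType.coord] at hℓ
        omega) ih' x (fun j _ _ => hx j (by omega) (by omega))
    rw [h1, gates_twentyWeight_diagonalPoints]
    refine gates_congr_on (p := fun x => x (.diagonal, -k + M) = false) _ _ _ ?_ ?_ _
      (hx _ (by omega) (by omega))
    · intro q _ x b hx
      rwa [Function.extend_apply' _ _ _ (by rintro ⟨a, ha⟩; exact gridLines_ne_diagonal _ _ _ ha)]
    · intro x hx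
      exact sweepAbove_gates_trianglePoints M _ k (hd _ (by omega) (by omega))
        (fun j h1 h2 => hv j (by omega) h2) (fun j h1 h2 => hh j (by omega) h2) x hx

/-! ### Compositions of gates as sums over edge configurations -/

/-- Points at which lines (one for each element of `L`) cross, the directed edges by which a line
enters and leaves a point, and the point preceding a point on a line through it. -/
structure LineNetwork (P L ι ε : Type*) where
  line : P → L → ι
  inEdge : P → L → ε
  outEdge : P → L → ε
  lineOf : ε → ι
  prev : P → L → P
  line_injective : ∀ p, Function.Injective (line p)
  lineOf_inEdge : ∀ p ℓ, lineOf (inEdge p ℓ) = line p ℓ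
  lineOf_outEdge : ∀ p ℓ, lineOf (outEdge p ℓ) = line p ℓ
  inEdge_eq : ∀ p q ℓ ℓ', inEdge p ℓ = inEdge q ℓ' → p = q
  outEdge_eq : ∀ p q ℓ ℓ', outEdge p ℓ = outEdge q ℓ' → p = q
  inEdge_eq_outEdge : ∀ p q ℓ ℓ', inEdge q ℓ = outEdge p ℓ' → p = prev q ℓ
  inEdge_eq_outEdge_prev : ∀ q ℓ, inEdge q ℓ = outEdge (prev q ℓ) ℓ

/-- Restriction to part of the lines. -/
def LineNetwork.comap {P L ι ε L' : Type*} (N : LineNetwork P L ι ε) (g : L' → L)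
    (hg : Function.Injective g) : LineNetwork P L' ι ε where
  line p a := N.line p (g a)
  inEdge p a := N.inEdge p (g a)
  outEdge p a := N.outEdge p (g a)
  lineOf := N.lineOf
  prev p a := N.prev p (g a)
  line_injective p := (N.line_injective p).comp hg
  lineOf_inEdge p a := N.lineOf_inEdge p (g a)
  lineOf_outEdge p a := N.lineOf_outEdge p (g a)
  inEdge_eq p q a b := N.inEdge_eq p q (g a) (g b)
  outEdge_eq p q a b := N.outEdge_eq p q (g a) (g b)
  inEdge_eq_outEdge p q a b := N.inEdge_eq_outEdge p q (g a) (g b)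
  inEdge_eq_outEdge_prev q a := N.inEdge_eq_outEdge_prev q (g a)

/-! ### Sums over the bits on a finite set of free edges -/

section Agree

variable {ε : Type*} [DecidableEq ε]

open Classical in
/-- The bit assignments that agree with `η` outside of `E`. -/
noncomputable def agreeOff (E : Finset ε) (η : ε → Bool) : Finset (ε → Bool) :=
  Finset.univ.image fun y : E → Bool => Function.updateFinset η E y

theorem mem_agreeOff {E : Finset ε} {η ξ : ε → Bool} :
    ξ ∈ agreeOff E η ↔ ∀ e ∉ E, ξ e = η e := by
  simp only [agreeOff, Finset.mem_image, Finset.mem_univ, true_and]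
  constructor
  · rintro ⟨y, rfl⟩ e he
    simp [Function.updateFinset, he]
  · intro h
    refine ⟨fun e => ξ e, ?_⟩
    funext e
    by_cases he : e ∈ E
    · simp [Function.updateFinset, he]
    · simp [Function.updateFinset, he, h e he]

theorem agreeOff_empty (η : ε → Bool) : agreeOff ∅ η = {η} := by
  ext ξ
  simp [mem_agreeOff, funext_iff]

/-- Fibring over the bits on the edges `o` splits off the choice made at one vertex, as the
induction in `gates_eq_sum` requires. -/
theorem sum_agreeOff_union {L : Type*} [Fintype L] [DecidableEq L] {o : L → ε}
    (ho : Function.Injective o) {E : Finset ε} (hE : ∀ ℓ, o ℓ ∉ E) (η : ε → Bool)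
    (F : (ε → Bool) → ℝ) :
    ∑ ξ ∈ agreeOff (Finset.univ.image o ∪ E) η, F ξ =
      ∑ b : L → Bool, ∑ ξ ∈ agreeOff E (Function.extend o b η), F ξ := by
  rw [← Finset.sum_fiberwise _ (fun ξ : ε → Bool => ξ ∘ o)]
  refine Finset.sum_congr rfl fun b _ => Finset.sum_congr ?_ fun _ _ => rfl
  ext ξ
  simp only [Finset.mem_filter, mem_agreeOff, Finset.mem_union, Finset.mem_image, Finset.mem_univ,
    true_and, not_or]
  constructor
  · rintro ⟨h, rfl⟩ e he
    by_cases ho' : ∃ ℓ, o ℓ = e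
    · obtain ⟨ℓ, rfl⟩ := ho'
      simp [ho.extend_apply]
    · rw [Function.extend_apply' _ _ _ ho', h e ⟨ho', he⟩]
  · intro h
    constructor
    · rintro e ⟨h1, h2⟩
      rw [h e h2, Function.extend_apply' _ _ _ h1]
    · funext ℓ
      rw [Function.comp_apply, h _ (hE ℓ), ho.extend_apply]

end Agree

/-! ### Following the lines of a network through an ordered list of points -/

namespace LineNetwork

variable {P L ι ε : Type*} (N : LineNetwork P L ι ε)

theorem outEdge_injective (p : P) : Function.Injective (N.outEdge p) := fun a b h =>
  N.line_injective p (by rw [← N.lineOf_outEdge, h, N.lineOf_outEdge])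

/-- The edges of the lines at which one arrives, starting from the edges `c`, after the points of a
list. -/
noncomputable def finalEdges (l : List P) (c : ι → ε) : ι → ε :=
  l.foldl (fun c p => Function.extend (N.line p) (N.outEdge p) c) c

/-- Every point comes after those preceding it on the lines through it. -/
def Ordered (l : List P) : Prop :=
  l.Pairwise (fun p q => p ≠ q ∧ ∀ ℓ, N.prev p ℓ ≠ q) ∧ ∀ p ∈ l, ∀ ℓ, N.prev p ℓ ≠ p

/-- The edges `c` are those by which lines enter the points of a list. -/
def StartsAt (l : List P) (c : ι → ε) : Prop :=
  (∀ k, N.lineOf (c k) = k) ∧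
    ∀ p ∈ l, ∀ ℓ, N.prev p ℓ ∉ l → c (N.line p ℓ) = N.inEdge p ℓ

variable {N}

theorem Ordered.tail {p : P} {l : List P} (h : N.Ordered (p :: l)) : N.Ordered l :=
  ⟨(List.pairwise_cons.1 h.1).2, fun q hq => h.2 q (by simp [hq])⟩

theorem Ordered.prev_notMem {p : P} {l : List P} (h : N.Ordered (p :: l)) (ℓ : L) :
    N.prev p ℓ ∉ p :: l := by
  rw [List.mem_cons, not_or]
  exact ⟨h.2 p (by simp) ℓ, fun hm => ((List.pairwise_cons.1 h.1).1 _ hm).2 ℓ rfl⟩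

theorem Ordered.notMem {p : P} {l : List P} (h : N.Ordered (p :: l)) : p ∉ l :=
  fun hm => ((List.pairwise_cons.1 h.1).1 _ hm).1 rfl

/-- Past `p`, the lines through `p` continue on its outgoing edges, which are the incoming edges of
the points having `p` as predecessor. No other entry is disturbed, because distinct points have
distinct incoming edges. -/
theorem StartsAt.tail {p : P} {l : List P} {c : ι → ε} (ho : N.Ordered (p :: l))
    (h : N.StartsAt (p :: l) c) :
    N.StartsAt l (Function.extend (N.line p) (N.outEdge p) c) := by
  constructor
  · intro k
    by_cases hk : ∃ ℓ, N.line p ℓ = k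
    · obtain ⟨ℓ, rfl⟩ := hk
      rw [(N.line_injective p).extend_apply, N.lineOf_outEdge]
    · rw [Function.extend_apply' _ _ _ hk, h.1]
  · intro q hq ℓ hprev
    by_cases hp : N.prev q ℓ = p
    · have h1 : N.inEdge q ℓ = N.outEdge p ℓ := by rw [N.inEdge_eq_outEdge_prev, hp]
      have h2 : N.line q ℓ = N.line p ℓ := by rw [← N.lineOf_inEdge, h1, N.lineOf_outEdge]
      rw [h2, (N.line_injective p).extend_apply, h1]
    · have h1 := h.2 q (by simp [hq]) ℓ (by simp [hp, hprev])
      rw [Function.extend_apply', h1]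
      rintro ⟨ℓ', hℓ'⟩
      have h2 := h.2 p (by simp) ℓ' (ho.prev_notMem ℓ')
      rw [hℓ', h1] at h2
      exact ho.notMem (N.inEdge_eq _ _ _ _ h2 ▸ hq)

theorem finalEdges_of_forall_ne {l : List P} {k : ι} (h : ∀ p ∈ l, ∀ ℓ, N.line p ℓ ≠ k)
    (c : ι → ε) : N.finalEdges l c k = c k := by
  induction l generalizing c with
  | nil => rfl
  | cons p l ih =>
    change N.finalEdges l (Function.extend (N.line p) (N.outEdge p) c) k = c k
    rw [ih fun q hq => h q (by simp [hq]), Function.extend_apply']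
    rintro ⟨ℓ, hℓ⟩
    exact h p (by simp) ℓ hℓ

theorem finalEdges_of_forall_inEdge_ne {l : List P} {c : ι → ε} (ho : N.Ordered l)
    (hc : N.StartsAt l c) {k : ι} (h : ∀ p ∈ l, ∀ ℓ, N.inEdge p ℓ ≠ c k) :
    N.finalEdges l c k = c k := by
  induction l generalizing c with
  | nil => rfl
  | cons p l ih =>
    have hk : ¬ ∃ ℓ, N.line p ℓ = k := by
      rintro ⟨ℓ, rfl⟩
      exact h p (by simp) ℓ (hc.2 p (by simp) ℓ (ho.prev_notMem ℓ)).symm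
    change N.finalEdges l (Function.extend (N.line p) (N.outEdge p) c) k = c k
    have e := Function.extend_apply' (f := N.line p) (N.outEdge p) c k hk
    rw [ih ho.tail (hc.tail ho) (fun q hq ℓ => e ▸ h q (by simp [hq]) ℓ), e]

/-- If `p` precedes no point of the list along `ℓ`, its outgoing edge is nobody's incoming edge, so
the line is not advanced again after `p`. -/
theorem finalEdges_line {l : List P} {c : ι → ε} (ho : N.Ordered l)
    (hc : N.StartsAt l c) {p : P} (hp : p ∈ l) {ℓ : L}
    (h : ∀ q ∈ l, N.prev q ℓ ≠ p) :
    N.finalEdges l c (N.line p ℓ) = N.outEdge p ℓ := by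
  induction l generalizing c with
  | nil => simp at hp
  | cons q l ih =>
    rcases List.mem_cons.1 hp with rfl | hp
    · have e := (N.line_injective p).extend_apply (N.outEdge p) c ℓ
      change N.finalEdges l (Function.extend (N.line p) (N.outEdge p) c) _ = _
      rw [finalEdges_of_forall_inEdge_ne ho.tail (hc.tail ho), e]
      intro r hr ℓ' h'
      rw [e] at h'
      have hℓ : N.prev r ℓ' = p := (N.inEdge_eq_outEdge _ _ _ _ h').symm
      have h2 := N.inEdge_eq_outEdge_prev r ℓ'
      rw [h', hℓ] at h2
      exact h r (by simp [hr]) (N.outEdge_injective p h2 ▸ hℓ)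
    · exact ih ho.tail (hc.tail ho) hp fun r hr => h r (by simp [hr])

variable [DecidableEq P] [Fintype L] [DecidableEq ε]

variable (N) in
/-- The edges by which lines leave the points of a list. -/
def outEdges (l : List P) : Finset ε := l.toFinset.biUnion fun p => Finset.univ.image (N.outEdge p)

variable (N) in
theorem mem_outEdges {l : List P} {e : ε} : e ∈ N.outEdges l ↔ ∃ p ∈ l, ∃ ℓ, N.outEdge p ℓ = e := by
  simp [outEdges]

variable [DecidableEq L]

/-- Each gate sums over the bits leaving its vertex, and the vertices have disjoint outgoing edges;
the successive choices thus amount to one choice of bits on all of them. -/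
theorem gates_eq_sum (w : (L → Bool) → (L → Bool) → ℝ) (φ : (ι → Bool) → ℝ) {l : List P}
    {c : ι → ε} (ho : N.Ordered l) (hc : N.StartsAt l c) (η : ε → Bool) :
    gates w N.line l φ (η ∘ c) =
      ∑ ξ ∈ agreeOff (N.outEdges l) η,
        (l.map fun p => w (ξ ∘ N.inEdge p) (ξ ∘ N.outEdge p)).prod * φ (ξ ∘ N.finalEdges l c) := by
  induction l generalizing c η with
  | nil => simp [gates, outEdges, finalEdges, agreeOff_empty]
  | cons p l ih =>
    have hE : N.outEdges (p :: l) = Finset.univ.image (N.outEdge p) ∪ N.outEdges l := by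
      ext e; simp [mem_outEdges]
    have hout : ∀ ℓ, N.outEdge p ℓ ∉ N.outEdges l := by
      intro ℓ hm
      obtain ⟨q, hq, ℓ', h⟩ := N.mem_outEdges.1 hm
      exact ho.notMem (N.outEdge_eq _ _ _ _ h ▸ hq)
    -- Because of the ordering, no later vertex rewrites the bits that `p` reads, so the full
    -- configuration `ξ` shows the same incoming bits as `η`.
    have hin : ∀ ℓ, N.inEdge p ℓ ∉ N.outEdges (p :: l) := by
      intro ℓ hm
      obtain ⟨q, hq, ℓ', h⟩ := N.mem_outEdges.1 hm
      exact ho.prev_notMem ℓ (N.inEdge_eq_outEdge _ _ _ _ h.symm ▸ hq)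
    have hcin : ∀ ℓ, c (N.line p ℓ) = N.inEdge p ℓ := fun ℓ =>
      hc.2 p (by simp) ℓ (ho.prev_notMem ℓ)
    rw [hE, sum_agreeOff_union (N.outEdge_injective p) hout]
    change gate w (N.line p) (gates w N.line l φ) (η ∘ c) = _
    refine Finset.sum_congr rfl fun b _ => ?_
    have hstate : Function.extend (N.line p) b (η ∘ c) =
        Function.extend (N.outEdge p) b η ∘ Function.extend (N.line p) (N.outEdge p) c := by
      funext k
      by_cases hk : ∃ ℓ, N.line p ℓ = k
      · obtain ⟨ℓ, rfl⟩ := hk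
        simp [(N.line_injective p).extend_apply, (N.outEdge_injective p).extend_apply]
      · rw [Function.comp_apply, Function.extend_apply' _ _ _ hk, Function.extend_apply' _ _ _ hk,
          Function.extend_apply']
        · rfl
        · rintro ⟨ℓ, hℓ⟩
          exact hk ⟨ℓ, by rw [← N.lineOf_outEdge, hℓ, hc.1]⟩
    rw [hstate, ih ho.tail (hc.tail ho), Finset.mul_sum]
    refine Finset.sum_congr rfl fun ξ hξ => ?_
    rw [List.map_cons, List.prod_cons, mul_assoc]
    rw [mem_agreeOff] at hξ
    have h1 : (η ∘ c) ∘ N.line p = ξ ∘ N.inEdge p := by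
      funext ℓ
      have hn := hin ℓ
      rw [hE, Finset.mem_union, not_or] at hn
      rw [Function.comp_apply, Function.comp_apply, Function.comp_apply, hcin, hξ _ hn.2,
        Function.extend_apply']
      simpa using hn.1
    have h2 : b = ξ ∘ N.outEdge p := by
      funext ℓ
      rw [Function.comp_apply, hξ _ (hout ℓ), (N.outEdge_injective p).extend_apply]
    rw [h1, h2]
    rfl

end LineNetwork

/-! ### Frozen vertices -/

/-- Different incoming bits leave conservation a single solution: both lines go straight through, at
the weight `b = √2`. -/
theorem gate_gridWeight_of_ne {p : ℤ × ℤ} (f : (TriLine → Bool) → ℝ) (x : TriLine → Bool)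
    (hx : x (lineThrough p .horizontal) ≠ x (lineThrough p .vertical)) :
    gate gridWeight (gridLines p) f x = Real.sqrt 2 * f x := by
  have hne : lineThrough p .horizontal ≠ lineThrough p .vertical := by simp [lineThrough]
  rw [← crossHV_eq_gate, crossHV, gate2_apply _ hne]
  have hu : ∀ a b, x (lineThrough p .horizontal) = a → x (lineThrough p .vertical) = b →
      Function.update (Function.update x (lineThrough p .horizontal) a)
        (lineThrough p .vertical) b = x := by
    rintro _ _ rfl rfl
    simp
  simp only [Fintype.sum_bool]
  cases h : x (lineThrough p .horizontal) <;> cases h' : x (lineThrough p .vertical) <;>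
    simp [sixWeight, h, h'] at hx ⊢
  · rw [hu _ _ h h']
  · rw [hu _ _ h h']

/-- The vertices at which the two initial bits differ are frozen if each of them precedes the other
vertices on the two grid lines through it. -/
theorem gates_gridWeight_filter {x₀ : TriLine → Bool} (φ : (TriLine → Bool) → ℝ)
    {l : List (ℤ × ℤ)}
    (hl : l.Pairwise fun p q =>
      x₀ (lineThrough p .horizontal) = x₀ (lineThrough p .vertical) →
      x₀ (lineThrough q .horizontal) ≠ x₀ (lineThrough q .vertical) → q.1 ≠ p.1 ∧ q.2 ≠ p.2)
    (x : TriLine → Bool)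
    (hx : ∀ q ∈ l, x₀ (lineThrough q .horizontal) ≠ x₀ (lineThrough q .vertical) →
      ∀ a, x (gridLines q a) = x₀ (gridLines q a)) :
    gates gridWeight gridLines l φ x =
      Real.sqrt 2 ^ (l.filter fun p =>
          x₀ (lineThrough p .horizontal) ≠ x₀ (lineThrough p .vertical)).length *
        gates gridWeight gridLines (l.filter fun p =>
          x₀ (lineThrough p .horizontal) = x₀ (lineThrough p .vertical)) φ x := by
  induction l generalizing x with
  | nil => simp [gates]
  | cons p l ih =>
    rw [List.pairwise_cons] at hl
    change gate gridWeight (gridLines p) (gates gridWeight gridLines l φ) x = _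
    by_cases hp : x₀ (lineThrough p .horizontal) = x₀ (lineThrough p .vertical)
    · rw [List.filter_cons_of_neg (by simpa using hp), List.filter_cons_of_pos (by simpa using hp)]
      change _ = _ * gate gridWeight (gridLines p) (gates gridWeight gridLines (l.filter _) φ) x
      rw [gate, gate, Finset.mul_sum]
      refine Finset.sum_congr rfl fun b _ => ?_
      rw [ih hl.2]
      · ring
      · intro q hq hne a
        rw [Function.extend_apply', hx q (by simp [hq]) hne]
        rintro ⟨a', ha⟩
        obtain ⟨h1, h2⟩ := hl.1 q hq hp hne
        exact gridLines_ne_of_ne h1.symm h2.symm a' a ha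
    · rw [List.filter_cons_of_pos (by simpa using hp), List.filter_cons_of_neg (by simpa using hp),
        gate_gridWeight_of_ne, ih hl.2 x fun q hq => hx q (by simp [hq]), List.length_cons]
      · ring
      · have h0 := hx p (by simp) hp 0
        have h1 := hx p (by simp) hp 1
        simp only [gridLines, Matrix.cons_val_zero, Matrix.cons_val_one] at h0 h1
        rwa [h0, h1]

/-! ### The twenty vertex model on the triangle as a composition of gates -/

/-- The lines of the triangular lattice, oriented to the right, to the lower right, and upwards. -/
def triNetwork : LineNetwork (ℤ × ℤ) LineType TriLine TriEdge where
  line := lineThrough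
  inEdge p ℓ := match ℓ with
    | .horizontal => (.horizontal, (p.1 - 1, p.2))
    | .diagonal => (.diagonal, (p.1 - 1, p.2 + 1))
    | .vertical => (.vertical, p)
  outEdge p ℓ := match ℓ with
    | .horizontal => (.horizontal, p)
    | .diagonal => (.diagonal, p)
    | .vertical => (.vertical, (p.1, p.2 + 1))
  lineOf e := lineThrough e.2 e.1
  prev p ℓ := match ℓ with
    | .horizontal => (p.1 - 1, p.2)
    | .diagonal => (p.1 - 1, p.2 + 1)
    | .vertical => (p.1, p.2 - 1)
  line_injective := lineThrough_injective
  lineOf_inEdge p ℓ := by cases ℓ <;> simp [lineThrough, LineType.coord]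
  lineOf_outEdge p ℓ := by cases ℓ <;> simp [lineThrough, LineType.coord]
  inEdge_eq p q ℓ ℓ' h := by
    cases ℓ <;> cases ℓ' <;> simp [Prod.ext_iff] at h ⊢ <;> omega
  outEdge_eq p q ℓ ℓ' h := by
    cases ℓ <;> cases ℓ' <;> simp [Prod.ext_iff] at h ⊢ <;> omega
  inEdge_eq_outEdge p q ℓ ℓ' h := by
    cases ℓ <;> cases ℓ' <;> simp [Prod.ext_iff] at h ⊢ <;> omega
  inEdge_eq_outEdge_prev q ℓ := by cases ℓ <;> simp

theorem pairwise_diagonalPoints (x y : ℤ) (k : ℕ) :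
    (diagonalPoints x y k).Pairwise fun p q => p.1 < q.1 := by
  induction k generalizing x y with
  | zero => exact List.Pairwise.nil
  | succ k ih =>
    refine List.pairwise_cons.2 ⟨fun q hq => ?_, ih _ _⟩
    rw [mem_diagonalPoints] at hq
    simp only
    omega

theorem pairwise_trianglePoints (M : ℤ) (k : ℕ) :
    (trianglePoints M k).Pairwise fun p q =>
      p.1 + p.2 < q.1 + q.2 ∨ p.1 + p.2 = q.1 + q.2 ∧ p.1 < q.1 := by
  induction k with
  | zero => exact List.Pairwise.nil
  | succ k ih =>
    refine List.pairwise_append.2 ⟨?_, ih, fun p hp q hq => ?_⟩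
    · refine (pairwise_diagonalPoints _ _ _).imp_of_mem fun hp hq h => ?_
      rw [mem_diagonalPoints] at hp hq
      omega
    · rw [mem_diagonalPoints] at hp
      rw [mem_trianglePoints] at hq
      omega

/-- A predecessor lies to the left, below or to the upper left: either `x + y` is smaller, or it is
equal and `x` is smaller. -/
theorem ordered_trianglePoints (M : ℤ) (k : ℕ) : triNetwork.Ordered (trianglePoints M k) := by
  refine ⟨(pairwise_trianglePoints M k).imp fun {p q} h => ⟨?_, fun ℓ => ?_⟩, fun p _ ℓ => ?_⟩
  on_goal 2 =>
    rintro rfl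
    omega
  all_goals cases ℓ <;> simp only [triNetwork, ne_eq, Prod.ext_iff] <;> omega

/-- The lines crossing the triangle of size `m`. -/
def triLines (m : ℕ) : Set TriLine := {k | match k.1 with
  | .vertical => -(m : ℤ) < k.2 ∧ k.2 ≤ 0
  | _ => 0 ≤ k.2 ∧ k.2 < m}

/-- The boundary bits at the lower left ends of the lines of the triangle of size `m`. -/
def boundaryBits (m : ℕ) : TriLine → Bool
  | (.horizontal, y) => decide ((m : ℤ) - 1 ≤ 2 * y)
  | (.vertical, x) => decide (-2 * x ≤ (m : ℤ) - 1)
  | (.diagonal, _) => false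

/-- The edges by which the lines enter the triangle of size `m`. -/
def triStart (m : ℕ) : TriLine → TriEdge
  | (.horizontal, y) => (.horizontal, (-y - 1, y))
  | (.vertical, x) => (.vertical, (x, -x))
  | (.diagonal, s) => (.diagonal, (s - m, m))

theorem mem_triPoints {m : ℕ} {p : ℤ × ℤ} :
    p ∈ trianglePoints ((m : ℤ) - 1) m ↔ p.1 ≤ 0 ∧ p.2 < m ∧ 0 ≤ p.1 + p.2 := by
  rw [mem_trianglePoints]; omega

theorem mem_triangle {m : ℕ} {p : ℤ × ℤ} :
    p ∈ triangle m ↔ p.1 ≤ 0 ∧ p.2 < m ∧ 0 ≤ p.1 + p.2 := by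
  simp only [triangle, Finset.mem_filter, Finset.mem_product, Finset.mem_Icc]; omega

theorem startsAt_triStart (m : ℕ) :
    triNetwork.StartsAt (trianglePoints ((m : ℤ) - 1) m) (triStart m) := by
  constructor
  · rintro ⟨ℓ, j⟩
    cases ℓ <;> simp [triNetwork, triStart, lineThrough, LineType.coord]
  · intro p hp ℓ hprev
    rw [mem_triPoints] at hp hprev
    cases ℓ <;> simp [triNetwork, triStart, lineThrough, LineType.coord, Prod.ext_iff] at hprev ⊢ <;>
      omega

theorem finalEdges_triStart {m : ℕ} {k : TriLine} (hk : k ∈ triLines m) :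
    triNetwork.finalEdges (trianglePoints ((m : ℤ) - 1) m) (triStart m) k =
      match k.1 with
      | .vertical => (.vertical, (k.2, m))
      | ℓ => (ℓ, (0, k.2)) := by
  have key := fun p (hp) ℓ => LineNetwork.finalEdges_line
    (ordered_trianglePoints ((m : ℤ) - 1) m) (startsAt_triStart m) (p := p) hp (ℓ := ℓ)
  obtain ⟨ℓ, j⟩ := k
  cases ℓ <;> simp only [triLines, Set.mem_ofPred_eq] at hk
  · refine (key (0, j) (by rw [mem_triPoints]; simp only; omega) .horizontal fun q hq => ?_)
    rw [mem_triPoints] at hq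
    simp only [triNetwork, ne_eq, Prod.ext_iff]
    omega
  · have := key (0, j) (by rw [mem_triPoints]; simp only; omega) .diagonal fun q hq => by
      rw [mem_triPoints] at hq
      simp only [triNetwork, ne_eq, Prod.ext_iff]
      omega
    simpa [triNetwork, lineThrough, LineType.coord] using this
  · have := key (j, m - 1) (by rw [mem_triPoints]; simp only; omega) .vertical fun q hq => by
      rw [mem_triPoints] at hq
      simp only [triNetwork, ne_eq, Prod.ext_iff]
      omega
    simpa [triNetwork, lineThrough, LineType.coord] using this

theorem mem_triEdges {m : ℕ} {e : TriEdge} :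
    e ∈ triEdges m ↔ e.start ∈ triangle m ∨ e.finish ∈ triangle m := by
  obtain ⟨ℓ, p⟩ := e
  simp only [triEdges, Finset.mem_biUnion, Finset.mem_univ, true_and, Finset.mem_union,
    Finset.mem_image, Prod.mk.injEq, TriEdge.start, TriEdge.finish]
  constructor
  · rintro ⟨ℓ', ⟨q, hq, rfl, rfl⟩ | ⟨q, hq, rfl, rfl⟩⟩
    · exact Or.inl hq
    · right; simpa using hq
  · rintro (h | h)
    · exact ⟨ℓ, Or.inl ⟨p, h, rfl, rfl⟩⟩
    · exact ⟨ℓ, Or.inr ⟨_, h, rfl, by simp⟩⟩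

theorem mem_outEdges_triPoints {m : ℕ} {e : TriEdge} :
    e ∈ triNetwork.outEdges (trianglePoints ((m : ℤ) - 1) m) ↔
      match e.1 with
      | .vertical => e.finish ∈ triangle m
      | _ => e.start ∈ triangle m := by
  rw [LineNetwork.mem_outEdges]
  simp only [mem_triPoints, mem_triangle]
  obtain ⟨ℓ, x, y⟩ := e
  constructor
  · rintro ⟨p, hp, ℓ', h⟩
    cases ℓ' <;> cases ℓ <;>
      simp [triNetwork, TriEdge.start, TriEdge.finish, LineType.step, Prod.ext_iff] at h ⊢ <;> omega
  · intro h
    cases ℓ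
    · exact ⟨(x, y), h, .horizontal, rfl⟩
    · exact ⟨(x, y), h, .diagonal, rfl⟩
    · refine ⟨(x, y - 1), ?_, .vertical, by simp [triNetwork]⟩
      simpa [TriEdge.finish, LineType.step, ← sub_eq_add_neg] using h

theorem outEdges_subset_triEdges (m : ℕ) :
    triNetwork.outEdges (trianglePoints ((m : ℤ) - 1) m) ⊆ triEdges m := by
  rintro ⟨ℓ, p⟩ he
  rw [mem_outEdges_triPoints] at he
  rw [mem_triEdges]
  cases ℓ
  exacts [Or.inl he, Or.inl he, Or.inr he]

/-! ### Orientations of the triangle as bit assignments on all edges -/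

namespace TriOrientation

variable {m : ℕ} (σ : TriOrientation m)

/-- The extension of an orientation to all edges of the triangular lattice. -/
noncomputable def extend (e : TriEdge) : Bool :=
  if h : e ∈ triEdges m then σ ⟨e, h⟩ else boundaryBits m (triNetwork.lineOf e)

theorem extend_coe (e : triEdges m) : σ.extend e = σ e := by simp [extend]

/-- The function `F` stands for either the head or the tail, so both counts in the ice rule are
reduced at once to the six edges at `p`. -/
theorem card_filter_eq (F : TriEdge → ℤ × ℤ) (f : triEdges m → ℤ × ℤ)
    (hf : ∀ e : triEdges m, f e = F e)
    (hF : ∀ e, F e = e.start ∨ F e = e.finish) {p : ℤ × ℤ} (hp : p ∈ triangle m) :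
    (Finset.univ.filter fun e => f e = p).card =
      ((if F (.horizontal, p) = p then 1 else 0) +
        if F (.horizontal, (p.1 - 1, p.2)) = p then 1 else 0) +
      ((if F (.diagonal, p) = p then 1 else 0) +
        if F (.diagonal, (p.1 - 1, p.2 + 1)) = p then 1 else 0) +
      ((if F (.vertical, p) = p then 1 else 0) +
        if F (.vertical, (p.1, p.2 + 1)) = p then 1 else 0) := by
  rw [Finset.card_filter]
  simp only [hf]
  rw [Finset.sum_coe_sort (triEdges m) fun e => if F e = p then 1 else 0,
    ← Finset.sum_subset (s₁ := {(.horizontal, p), (.horizontal, (p.1 - 1, p.2)), (.diagonal, p),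
      (.diagonal, (p.1 - 1, p.2 + 1)), (.vertical, p), (.vertical, (p.1, p.2 + 1))})]
  · rw [Finset.sum_insert (by simp [Prod.ext_iff]; omega), Finset.sum_insert (by simp [Prod.ext_iff]),
      Finset.sum_insert (by simp [Prod.ext_iff]), Finset.sum_insert (by simp [Prod.ext_iff]),
      Finset.sum_insert (by simp [Prod.ext_iff]), Finset.sum_singleton]
    ring
  · intro e he
    simp only [Finset.mem_insert, Finset.mem_singleton] at he
    rw [mem_triEdges]
    rcases he with rfl | rfl | rfl | rfl | rfl | rfl <;>
      simp [TriEdge.start, TriEdge.finish, LineType.step, hp]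
  · rintro ⟨ℓ, q⟩ _ he
    rw [if_neg]
    rintro rfl
    apply he
    rcases hF (ℓ, q) with h | h <;> rw [h] <;> cases ℓ <;>
      simp [TriEdge.start, TriEdge.finish, LineType.step]

/-- Vertical lines are travelled upwards although `true` means down on them; this is why the
vertical bits change sides in the conservation law of `twentyWeight`. -/
theorem ice_iff {p : ℤ × ℤ} (hp : p ∈ triangle m) :
    ((Finset.univ.filter fun e => σ.head e = p).card = 3 ∧
      (Finset.univ.filter fun e => σ.tail e = p).card = 3) ↔
    twentyWeight (σ.extend ∘ triNetwork.inEdge p) (σ.extend ∘ triNetwork.outEdge p) = 1 := by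
  rw [card_filter_eq (fun e => if σ.extend e then e.finish else e.start) σ.head
      (fun e => by simp only [extend_coe]; rfl) (fun e => by split_ifs <;> simp) hp,
    card_filter_eq (fun e => if σ.extend e then e.start else e.finish) σ.tail
      (fun e => by simp only [extend_coe]; rfl) (fun e => by split_ifs <;> simp) hp]
  simp only [twentyWeight, Function.comp_apply, triNetwork, TriEdge.start, TriEdge.finish,
    LineType.step]
  obtain ⟨a, ha⟩ : ∃ a, σ.extend (.horizontal, p) = a := ⟨_, rfl⟩
  obtain ⟨b, hb⟩ : ∃ b, σ.extend (.diagonal, p) = b := ⟨_, rfl⟩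
  obtain ⟨c, hc⟩ : ∃ c, σ.extend (.vertical, p) = c := ⟨_, rfl⟩
  obtain ⟨a', ha'⟩ : ∃ a, σ.extend (.horizontal, (p.1 - 1, p.2)) = a := ⟨_, rfl⟩
  obtain ⟨b', hb'⟩ : ∃ b, σ.extend (.diagonal, (p.1 - 1, p.2 + 1)) = b := ⟨_, rfl⟩
  obtain ⟨c', hc'⟩ : ∃ c, σ.extend (.vertical, (p.1, p.2 + 1)) = c := ⟨_, rfl⟩
  simp only [ha, hb, hc, ha', hb', hc']
  cases a <;> cases b <;> cases c <;> cases a' <;> cases b' <;> cases c' <;> simp [Prod.ext_iff]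

end TriOrientation

namespace TriOrientation

variable {m : ℕ}

theorem pointsIn_iff {σ : TriOrientation m} {e : triEdges m} :
    (TriEdge.start e ∉ triangle m → (σ.PointsIn e ↔ σ e = true)) ∧
      (TriEdge.finish e ∉ triangle m → (σ.PointsIn e ↔ σ e = false)) := by
  have := mem_triEdges.1 e.2
  constructor <;> intro h <;> cases he : σ e <;> simp_all [PointsIn, head, tail]

theorem pointsOut_iff {σ : TriOrientation m} {e : triEdges m} :
    (TriEdge.start e ∉ triangle m → (σ.PointsOut e ↔ σ e = false)) ∧
      (TriEdge.finish e ∉ triangle m → (σ.PointsOut e ↔ σ e = true)) := by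
  have := mem_triEdges.1 e.2
  constructor <;> intro h <;> cases he : σ e <;> simp_all [PointsOut, head, tail]

/-- The boundary conditions in terms of the incoming and outgoing bits of the lines. -/
theorem dwbc3_iff {σ : TriOrientation m} :
    σ.DWBC3 ↔
      (∀ e ∉ triNetwork.outEdges (trianglePoints ((m : ℤ) - 1) m),
        σ.extend e = boundaryBits m (triNetwork.lineOf e)) ∧
      ∀ k ∈ triLines m, σ.extend
        (triNetwork.finalEdges (trianglePoints ((m : ℤ) - 1) m) (triStart m) k) = false := by
  constructor
  · intro h
    constructor
    · rintro ⟨ℓ, x, y⟩ he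
      by_cases hm : (⟨ℓ, x, y⟩ : TriEdge) ∈ triEdges m
      · have hval := σ.extend_coe ⟨_, hm⟩
        simp only at hval
        rw [hval]
        have hout := fun h => (pointsOut_iff (σ := σ) (e := ⟨_, hm⟩)).1 h
        have hout' := fun h => (pointsOut_iff (σ := σ) (e := ⟨_, hm⟩)).2 h
        have hin := fun h => (pointsIn_iff (σ := σ) (e := ⟨_, hm⟩)).1 h
        have hin' := fun h => (pointsIn_iff (σ := σ) (e := ⟨_, hm⟩)).2 h
        have h1 := h.north ⟨_, hm⟩
        have h2 := h.top_half_west ⟨_, hm⟩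
        have h3 := h.top_half_south ⟨_, hm⟩
        have h4 := h.bottom_half_west ⟨_, hm⟩
        have h5 := h.bottom_half_south ⟨_, hm⟩
        have h6 := h.center_west ⟨_, hm⟩
        have h7 := h.center_south ⟨_, hm⟩
        rw [mem_triEdges] at hm
        rw [mem_outEdges_triPoints] at he
        cases ℓ <;> simp only [mem_triangle, TriEdge.start, TriEdge.finish, LineType.step,
          Prod.mk_add_mk, triNetwork, lineThrough, LineType.coord, boundaryBits] at *
        · have hs : x + y = -1 := by omega
          -- At the center vertex the West edge points in and the South edge out, so both carry
          -- `true`; hence the weak inequalities in both clauses of `boundaryBits`.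
          rcases lt_trichotomy (2 * y) ((m : ℤ) - 1) with hlt | heq | hgt
          · rw [(hout (by omega)).1 (h4 hs (by omega))]
            simp; omega
          · rw [(hin (by omega)).1 (h6 hs (by omega))]
            simp [heq]
          · rw [(hin (by omega)).1 (h2 hs (by omega))]
            simp [hgt.le]
        · exact (hout (by omega)).1 (h1 (by omega))
        · have hs : x + 0 + (y + -1) = -1 := by omega
          rcases lt_trichotomy (2 * y) ((m : ℤ) - 1) with hlt | heq | hgt
          · rw [(hout' (by omega)).1 (h5 hs (by omega))]
            simp; omega
          · rw [(hout' (by omega)).1 (h7 hs (by omega))]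
            simp; omega
          · rw [(hin' (by omega)).1 (h3 hs (by omega))]
            simp; omega
      · simp [extend, hm]
    · rintro ⟨ℓ, j⟩ hk
      rw [finalEdges_triStart hk]
      cases ℓ <;> simp only [triLines, Set.mem_ofPred_eq] at hk ⊢
      · have hm : (⟨.horizontal, 0, j⟩ : TriEdge) ∈ triEdges m := by
          simp only [mem_triEdges, mem_triangle, TriEdge.start]; omega
        rw [σ.extend_coe ⟨_, hm⟩, ← pointsIn_iff.2]
        · exact h.east _ (by simp [TriEdge.finish, LineType.step])
        · simp [mem_triangle, TriEdge.finish, LineType.step]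
      · have hm : (⟨.diagonal, 0, j⟩ : TriEdge) ∈ triEdges m := by
          simp only [mem_triEdges, mem_triangle, TriEdge.start]; omega
        rw [σ.extend_coe ⟨_, hm⟩, ← pointsIn_iff.2]
        · exact h.east _ (by simp [TriEdge.finish, LineType.step])
        · simp [mem_triangle, TriEdge.finish, LineType.step]
      · have hm : (⟨.vertical, j, m⟩ : TriEdge) ∈ triEdges m := by
          simp only [mem_triEdges, mem_triangle, TriEdge.finish, LineType.step, Prod.mk_add_mk]
          omega
        rw [σ.extend_coe ⟨_, hm⟩, ← pointsOut_iff.1]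
        · exact h.north _ rfl
        · simp [mem_triangle, TriEdge.start]
  · rintro ⟨hb, hf⟩
    have hf' : ∀ ℓ j, (ℓ, j) ∈ triLines m → _ := fun ℓ j hk => finalEdges_triStart hk ▸ hf _ hk
    have hh := hf' .horizontal
    have hd := hf' .diagonal
    have hv := hf' .vertical
    simp only [triLines, Set.mem_ofPred_eq] at hh hd hv
    simp only [mem_outEdges_triPoints] at hb
    clear hf hf'
    constructor <;> rintro ⟨⟨ℓ, x, y⟩, he⟩ <;>
      have hval := σ.extend_coe ⟨_, he⟩ <;>
      have hout := fun h => (pointsOut_iff (σ := σ) (e := ⟨_, he⟩)).1 h <;>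
      have hout' := fun h => (pointsOut_iff (σ := σ) (e := ⟨_, he⟩)).2 h <;>
      have hin := fun h => (pointsIn_iff (σ := σ) (e := ⟨_, he⟩)).1 h <;>
      have hin' := fun h => (pointsIn_iff (σ := σ) (e := ⟨_, he⟩)).2 h <;>
      have hb' := hb (ℓ, x, y) <;> clear hb <;>
      rw [mem_triEdges] at he <;>
      cases ℓ <;> simp only [mem_triangle, TriEdge.start, TriEdge.finish, LineType.step,
          Prod.mk_add_mk, triNetwork, lineThrough, LineType.coord, boundaryBits] at *
    all_goals
      intros
      try (exfalso; omega)
    -- Each remaining edge is either one by which a line enters the triangle, covered by `hb'`, or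
    -- the last edge of a line, in the column `0` or on top at height `m`, covered by `hh`, `hd` or
    -- `hv`.
    all_goals
      first
        | rw [hout (by omega), ← hval]
        | rw [hin (by omega), ← hval]
        | rw [hout' (by omega), ← hval]
        | rw [hin' (by omega), ← hval]
      first
        | exact hb' (by omega)
        | (rw [hb' (by omega)]; simp; omega)
        | (obtain rfl : x = 0 := by omega
           first | exact hh _ (by omega) | exact hd _ (by omega))
        | (obtain rfl : y = m := by omega
           exact hv _ (by omega))

theorem extend_injective : Function.Injective (extend (m := m)) := fun σ τ h => by
  funext e
  rw [← extend_coe σ, h, extend_coe]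

theorem extend_restrict {ξ : TriEdge → Bool}
    (h : ∀ e ∉ triNetwork.outEdges (trianglePoints ((m : ℤ) - 1) m),
      ξ e = boundaryBits m (triNetwork.lineOf e)) :
    extend (m := m) (fun e => ξ e) = ξ := by
  funext e
  by_cases he : e ∈ triEdges m
  · simp [extend, he]
  · simp [extend, he, h e fun h' => he (outEdges_subset_triEdges m h')]

end TriOrientation

theorem prod_map_twentyWeight {P : Type*} (l : List P) (a b : P → LineType → Bool)
    [Decidable (∀ p ∈ l, twentyWeight (a p) (b p) = 1)] :
    (l.map fun p => twentyWeight (a p) (b p)).prod =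
      if ∀ p ∈ l, twentyWeight (a p) (b p) = 1 then 1 else 0 := by
  split_ifs with h
  · exact List.prod_eq_one (by simpa using h)
  · push Not at h
    obtain ⟨p, hp, hne⟩ := h
    refine List.prod_eq_zero (List.mem_map.2 ⟨p, hp, ?_⟩)
    unfold twentyWeight at hne ⊢
    split_ifs at hne ⊢ with h
    · exact absurd rfl hne
    · rfl

open Classical in
/-- The number of configurations as a composition of gates. -/
theorem numConfigurations20V3_eq_gates (m : ℕ) :
    (numConfigurations20V3 m : ℝ) =
      gates twentyWeight lineThrough (trianglePoints ((m : ℤ) - 1) m) (allFalse (triLines m))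
        (boundaryBits m) := by
  have hstart := startsAt_triStart m
  have h := LineNetwork.gates_eq_sum twentyWeight (allFalse (triLines m))
    (ordered_trianglePoints ((m : ℤ) - 1) m) hstart (boundaryBits m ∘ triNetwork.lineOf)
  have hx : (boundaryBits m ∘ triNetwork.lineOf) ∘ triStart m = boundaryBits m := by
    funext k
    simp [hstart.1 k]
  rw [hx] at h
  change _ = gates twentyWeight triNetwork.line _ _ _
  rw [h]
  simp only [prod_map_twentyWeight, allFalse, ite_mul, one_mul, zero_mul, ← ite_and]
  rw [← Finset.sum_filter, Finset.sum_const, nsmul_one, numConfigurations20V3,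
    Nat.subtype_card (Finset.univ.filter fun σ : TriOrientation m => σ.IceRule ∧ σ.DWBC3)
      (by simp), Nat.cast_inj]
  have hice : ∀ σ : TriOrientation m, σ.IceRule ↔
      ∀ p ∈ trianglePoints ((m : ℤ) - 1) m,
        twentyWeight (σ.extend ∘ triNetwork.inEdge p) (σ.extend ∘ triNetwork.outEdge p) = 1 := by
    intro σ
    refine forall_congr' fun p => ?_
    rw [mem_triPoints, ← mem_triangle]
    exact forall_congr' fun hp => σ.ice_iff hp
  refine Finset.card_bij (fun σ _ => σ.extend) (fun σ hσ => ?_)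
    (fun _ _ _ _ h => TriOrientation.extend_injective h) fun ξ hξ => ?_
  · simp only [Finset.mem_filter, Finset.mem_univ, true_and, mem_agreeOff] at hσ ⊢
    rw [hice, TriOrientation.dwbc3_iff] at hσ
    exact ⟨hσ.2.1, hσ.1, hσ.2.2⟩
  · simp only [Finset.mem_filter, mem_agreeOff] at hξ
    have hext := TriOrientation.extend_restrict hξ.1
    refine ⟨fun e => ξ e, ?_, hext⟩
    simp only [Finset.mem_filter, Finset.mem_univ, true_and]
    rw [hice, TriOrientation.dwbc3_iff, hext]
    exact ⟨hξ.2.1, hξ.1, hξ.2.2⟩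

/-! ### The six vertex model on the square as a composition of gates -/

/-- The horizontal and vertical lines of the triangular lattice. -/
def gridNetwork : LineNetwork (ℤ × ℤ) (Fin 2) TriLine TriEdge :=
  triNetwork.comap ![.horizontal, .vertical] (by
    intro a b h; fin_cases a <;> fin_cases b <;> simp_all)

theorem gridNetwork_line : gridNetwork.line = gridLines := by
  funext p a; fin_cases a <;> rfl

/-- The points of the triangle that are not frozen. -/
noncomputable def squarePoints (m : ℕ) : List (ℤ × ℤ) :=
  (trianglePoints ((m : ℤ) - 1) m).filter fun p =>
    boundaryBits m (lineThrough p .horizontal) = boundaryBits m (lineThrough p .vertical)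

/-- Two equal bits must both be `true`: both being `false` would mean `2y < m - 1 < -2x`, against `x
+ y ≥ 0`. The two remaining inequalities bound a square. -/
theorem mem_squarePoints {m n : ℕ} (hm : m = 2 * n ∨ m + 1 = 2 * n) {p : ℤ × ℤ} :
    p ∈ squarePoints m ↔ -(n : ℤ) < p.1 ∧ p.1 ≤ 0 ∧ (m : ℤ) - n ≤ p.2 ∧ p.2 < m := by
  simp only [squarePoints, List.mem_filter, mem_triPoints, decide_eq_true_eq, boundaryBits,
    lineThrough, LineType.coord, decide_eq_decide]
  omega

theorem pairwise_squarePoints (m : ℕ) : (squarePoints m).Pairwise fun p q =>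
    p.1 + p.2 < q.1 + q.2 ∨ p.1 + p.2 = q.1 + q.2 ∧ p.1 < q.1 :=
  (pairwise_trianglePoints _ _).filter _

theorem nodup_of_pairwise {l : List (ℤ × ℤ)} (h : l.Pairwise fun p q =>
    p.1 + p.2 < q.1 + q.2 ∨ p.1 + p.2 = q.1 + q.2 ∧ p.1 < q.1) : l.Nodup :=
  h.imp fun {p q} h => by rintro rfl; omega

theorem ordered_squarePoints (m : ℕ) : gridNetwork.Ordered (squarePoints m) := by
  have h := ordered_trianglePoints ((m : ℤ) - 1) m
  exact ⟨(h.1.filter _).imp fun {p q} h => ⟨h.1, fun a => h.2 _⟩,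
    fun p hp a => h.2 p (List.mem_of_mem_filter hp) _⟩

/-- The edges by which the grid lines enter the square. -/
def squareStart (m n : ℕ) : TriLine → TriEdge
  | (.horizontal, y) => (.horizontal, (-n, y))
  | (.vertical, x) => (.vertical, (x, m - n))
  | (.diagonal, s) => (.diagonal, (0, s))

theorem startsAt_squareStart {m n : ℕ} (hm : m = 2 * n ∨ m + 1 = 2 * n) :
    gridNetwork.StartsAt (squarePoints m) (squareStart m n) := by
  constructor
  · rintro ⟨ℓ, j⟩
    cases ℓ <;> simp [gridNetwork, LineNetwork.comap, triNetwork, squareStart, lineThrough,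
      LineType.coord]
  · intro p hp a hprev
    rw [mem_squarePoints hm] at hp hprev
    fin_cases a <;> simp [gridNetwork, LineNetwork.comap, triNetwork, squareStart, lineThrough,
      LineType.coord, Prod.ext_iff] at hprev ⊢ <;> omega

theorem mem_outEdges_squarePoints {m n : ℕ} (hm : m = 2 * n ∨ m + 1 = 2 * n) {e : TriEdge} :
    e ∈ gridNetwork.outEdges (squarePoints m) ↔
      -(n : ℤ) < e.2.1 ∧ e.2.1 ≤ 0 ∧ (m : ℤ) - n ≤ e.2.2 ∧ e.2.2 ≤ m ∧ match e.1 with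
        | .horizontal => e.2.2 ≠ m
        | .vertical => e.2.2 ≠ m - n
        | .diagonal => False := by
  rw [LineNetwork.mem_outEdges]
  simp only [mem_squarePoints hm]
  obtain ⟨ℓ, x, y⟩ := e
  constructor
  · rintro ⟨p, hp, a, h⟩
    fin_cases a <;> cases ℓ <;>
      simp [gridNetwork, LineNetwork.comap, triNetwork, Prod.ext_iff] at h ⊢ <;> omega
  · intro h
    cases ℓ <;> simp only at h
    · exact ⟨(x, y), by omega, 0, rfl⟩
    · exact h.2.2.2.2.elim
    · exact ⟨(x, y - 1), by simp only; omega, 1,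
        by simp [gridNetwork, LineNetwork.comap, triNetwork]⟩

theorem finalEdges_squareStart {m n : ℕ} (hm : m = 2 * n ∨ m + 1 = 2 * n) :
    (∀ y : ℤ, (m : ℤ) - n ≤ y → y < m → gridNetwork.finalEdges (squarePoints m) (squareStart m n)
      (.horizontal, y) = (LineType.horizontal, (0, y))) ∧
    (∀ x : ℤ, -(n : ℤ) < x → x ≤ 0 → gridNetwork.finalEdges (squarePoints m) (squareStart m n)
      (.vertical, x) = (LineType.vertical, (x, (m : ℤ)))) := by
  have key := fun p (hp) a => LineNetwork.finalEdges_line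
    (ordered_squarePoints m) (startsAt_squareStart hm) (p := p) hp (ℓ := a)
  constructor
  · intro y h1 h2
    refine key (0, y) (by rw [mem_squarePoints hm]; simp only; omega) 0 fun q hq => ?_
    rw [mem_squarePoints hm] at hq
    simp [gridNetwork, LineNetwork.comap, triNetwork, Prod.ext_iff]
    omega
  · intro x h1 h2
    have := key (x, m - 1) (by rw [mem_squarePoints hm]; simp only; omega) 1 fun q hq => by
      rw [mem_squarePoints hm] at hq
      simp [gridNetwork, LineNetwork.comap, triNetwork, Prod.ext_iff]
      omega
    simpa [gridNetwork, LineNetwork.comap, triNetwork, lineThrough, LineType.coord] using this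

/-- The frozen final bits in terms of the bits of the North and East edges of the square. -/
theorem forall_triLines_iff {m n : ℕ} (hm : m = 2 * n ∨ m + 1 = 2 * n)
    {ξ : TriEdge → Bool} (hξ : ∀ e ∉ gridNetwork.outEdges (squarePoints m),
      ξ e = boundaryBits m (gridNetwork.lineOf e)) :
    (∀ k ∈ triLines m,
      ξ (gridNetwork.finalEdges (squarePoints m) (squareStart m n) k) = false) ↔
    (∀ y : ℤ, (m : ℤ) - n ≤ y → y < m → ξ (.horizontal, (0, y)) = false) ∧
      ∀ x : ℤ, -(n : ℤ) < x → x ≤ 0 → ξ (.vertical, (x, m)) = false := by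
  obtain ⟨fh, fv⟩ := finalEdges_squareStart hm
  constructor
  · intro h
    refine ⟨fun y h1 h2 => ?_, fun x h1 h2 => ?_⟩
    · rw [← fh y h1 h2]
      exact h _ (by simp only [triLines, Set.mem_ofPred_eq]; omega)
    · rw [← fv x h1 h2]
      exact h _ (by simp only [triLines, Set.mem_ofPred_eq]; omega)
  · rintro ⟨hh, hv⟩ ⟨ℓ, j⟩ hk
    -- A line that misses the square keeps its initial bit, which is `false` for the rows below the
    -- square, the columns to its left and all diagonals.
    have hrest : (∀ p ∈ squarePoints m, ∀ a, gridNetwork.line p a ≠ (ℓ, j)) →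
        squareStart m n (ℓ, j) ∉ gridNetwork.outEdges (squarePoints m) →
        boundaryBits m (ℓ, j) = false →
        ξ (gridNetwork.finalEdges (squarePoints m) (squareStart m n) (ℓ, j)) = false := by
      intro h1 h2 h3
      rw [LineNetwork.finalEdges_of_forall_ne h1, hξ _ h2, (startsAt_squareStart hm).1, h3]
    rw [gridNetwork_line] at hrest
    simp only [mem_squarePoints hm, mem_outEdges_squarePoints hm] at hrest
    cases ℓ <;> simp only [triLines, Set.mem_ofPred_eq] at hk
    · by_cases hj : (m : ℤ) - n ≤ j
      · rw [fh j hj hk.2]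
        exact hh j hj hk.2
      · refine hrest ?_ ?_ ?_
        · intro p hp a
          fin_cases a <;> simp [gridLines, lineThrough, LineType.coord]
          omega
        · simp [squareStart]
        · simp [boundaryBits]
          omega
    · refine hrest ?_ ?_ ?_
      · exact fun p _ a => gridLines_ne_diagonal p a j
      · simp [squareStart]
      · simp [boundaryBits]
    · by_cases hj : -(n : ℤ) < j
      · rw [fv j hj hk.2]
        exact hv j hj hk.2
      · refine hrest ?_ ?_ ?_
        · intro p hp a
          fin_cases a <;> simp [gridLines, lineThrough, LineType.coord]
          omega
        · simp [squareStart]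
        · simp [boundaryBits]
          omega

/-- The point of the triangle in row `i` and column `j` of the square. -/
def squarePoint (m n : ℕ) (q : Fin n × Fin n) : ℤ × ℤ := (q.2 - n + 1, m - 1 - q.1)

theorem squarePoint_injective (m n : ℕ) : Function.Injective (squarePoint m n) := by
  rintro ⟨i, j⟩ ⟨i', j'⟩ h
  simp only [squarePoint, Prod.ext_iff, Fin.ext_iff] at h ⊢
  omega

theorem toFinset_squarePoints {m n : ℕ} (hm : m = 2 * n ∨ m + 1 = 2 * n) :
    (squarePoints m).toFinset = Finset.univ.image (squarePoint m n) := by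
  ext ⟨x, y⟩
  simp only [List.mem_toFinset, mem_squarePoints hm, Finset.mem_image, Finset.mem_univ, true_and,
    squarePoint, Prod.exists, Prod.mk.injEq]
  constructor
  · intro h
    refine ⟨⟨(m - 1 - y).toNat, by omega⟩, ⟨(x + n - 1).toNat, by omega⟩, ?_, ?_⟩ <;>
      simp only <;> omega
  · rintro ⟨i, j, h1, h2⟩
    omega

theorem length_squarePoints {m n : ℕ} (hm : m = 2 * n ∨ m + 1 = 2 * n) :
    (squarePoints m).length = n * n := by
  rw [← List.toFinset_card_of_nodup (nodup_of_pairwise (pairwise_squarePoints m)),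
    toFinset_squarePoints hm, Finset.card_image_of_injective _ (squarePoint_injective m n)]
  simp

theorem prod_map_squarePoints {m n : ℕ} (hm : m = 2 * n ∨ m + 1 = 2 * n) (F : ℤ × ℤ → ℝ) :
    ((squarePoints m).map F).prod = ∏ i : Fin n, ∏ j : Fin n, F (squarePoint m n (i, j)) := by
  rw [← List.prod_toFinset _ (nodup_of_pairwise (pairwise_squarePoints m)),
    toFinset_squarePoints hm, Finset.prod_image (squarePoint_injective m n).injOn,
    ← Finset.univ_product_univ, Finset.prod_product]

/-! ### Dictionary between orientations of the square and edge configurations -/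

namespace SquareOrientation

variable {n : ℕ}

@[ext]
theorem ext' {τ τ' : SquareOrientation n} (h : ∀ i j, τ.hor i j = τ'.hor i j)
    (h' : ∀ i j, τ.ver i j = τ'.ver i j) : τ = τ' := by
  obtain ⟨a, b⟩ := τ
  obtain ⟨a', b'⟩ := τ'
  congr
  · funext i j; exact h i j
  · funext i j; exact h' i j

theorem prod_sixWeight (a b c : ℝ) (τ : SquareOrientation n) [Decidable τ.IceRule] :
    ∏ i, ∏ j, sixWeight a b c (τ.west i j) (τ.south i j) (τ.east i j) (τ.north i j) =
      if τ.IceRule then ∏ i, ∏ j, τ.vertexWeight a b c i j else 0 := by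
  have hiff : ∀ i j, ((τ.west i j).toNat + (!τ.east i j).toNat + (τ.north i j).toNat +
      (!τ.south i j).toNat = 2 ↔ (τ.west i j).toNat + (τ.north i j).toNat =
        (τ.east i j).toNat + (τ.south i j).toNat) := by
    intro i j
    cases τ.west i j <;> cases τ.east i j <;> cases τ.north i j <;> cases τ.south i j <;> simp
  split_ifs with h
  · refine Finset.prod_congr rfl fun i _ => Finset.prod_congr rfl fun j _ => ?_
    rw [sixWeight, if_pos ((hiff i j).1 (h i j)), vertexWeight]
  · simp only [IceRule, hiff] at h
    push Not at h
    obtain ⟨i, j, h⟩ := h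
    refine Finset.prod_eq_zero (Finset.mem_univ i) (Finset.prod_eq_zero (Finset.mem_univ j) ?_)
    rw [sixWeight, if_neg h]

/-- The restriction of an edge configuration to the square in the corner of the triangle. -/
def ofEdges (m n : ℕ) (ξ : TriEdge → Bool) : SquareOrientation n where
  hor i j := ξ (.horizontal, (j - n, m - 1 - i))
  ver i j := ξ (.vertical, (j - n + 1, m - i))

/-- The extension of an orientation of the square to the whole lattice. -/
def toEdges (m : ℕ) (τ : SquareOrientation n) (e : TriEdge) : Bool :=
  match e with
  | (.horizontal, (x, y)) =>
    if h : (-(n : ℤ) ≤ x ∧ x ≤ 0) ∧ (m : ℤ) - n ≤ y ∧ y < m then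
      τ.hor ⟨(m - 1 - y).toNat, by omega⟩ ⟨(x + n).toNat, by omega⟩
    else boundaryBits m (.horizontal, y)
  | (.vertical, (x, y)) =>
    if h : (-(n : ℤ) < x ∧ x ≤ 0) ∧ (m : ℤ) - n ≤ y ∧ y ≤ m then
      τ.ver ⟨(m - y).toNat, by omega⟩ ⟨(x + n - 1).toNat, by omega⟩
    else boundaryBits m (.vertical, x)
  | (.diagonal, _) => false

theorem ofEdges_toEdges (m : ℕ) (τ : SquareOrientation n) : ofEdges m n (τ.toEdges m) = τ := by
  ext i j
  · simp only [ofEdges, toEdges]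
    rw [dif_pos (by omega)]
    congr 1 <;> ext <;> simp only <;> omega
  · simp only [ofEdges, toEdges]
    rw [dif_pos (by omega)]
    congr 1 <;> ext <;> simp only <;> omega

/-- The only edges of the square not leaving one of its vertices are the West and South external
ones; the domain walls orient them right and down, and `boundaryBits` is `true` there. -/
theorem toEdges_of_notMem {m : ℕ} (hm : m = 2 * n ∨ m + 1 = 2 * n) {τ : SquareOrientation n}
    (hτ : τ.DWBC) (e : TriEdge) (he : e ∉ gridNetwork.outEdges (squarePoints m)) :
    τ.toEdges m e = boundaryBits m (gridNetwork.lineOf e) := by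
  rw [mem_outEdges_squarePoints hm] at he
  obtain ⟨ℓ, x, y⟩ := e
  cases ℓ <;> simp only [toEdges, gridNetwork, LineNetwork.comap, triNetwork, lineThrough,
    LineType.coord] at he ⊢
  · split_ifs with h
    · have : (⟨(x + n).toNat, by omega⟩ : Fin (n + 1)) = 0 := by ext; simp; omega
      rw [this, (hτ.1 _).1]
      simp [boundaryBits]
      omega
    · rfl
  · rfl
  · split_ifs with h
    · have : (⟨(m - y).toNat, by omega⟩ : Fin (n + 1)) = Fin.last n := by ext; simp; omega
      rw [this, (hτ.2 _).2]
      simp [boundaryBits]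
      omega
    · rfl

theorem toEdges_ofEdges {m : ℕ} (hm : m = 2 * n ∨ m + 1 = 2 * n) {ξ : TriEdge → Bool}
    (hξ : ∀ e ∉ gridNetwork.outEdges (squarePoints m),
      ξ e = boundaryBits m (gridNetwork.lineOf e)) : (ofEdges m n ξ).toEdges m = ξ := by
  simp only [mem_outEdges_squarePoints hm] at hξ
  funext e
  obtain ⟨ℓ, x, y⟩ := e
  have h := hξ (ℓ, (x, y))
  cases ℓ <;> simp only [toEdges, ofEdges, gridNetwork, LineNetwork.comap, triNetwork, lineThrough,
    LineType.coord] at h ⊢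
  · split_ifs with h'
    · congr 3 <;> omega
    · exact (h (by omega)).symm
  · exact (h (by simp)).symm
  · split_ifs with h'
    · congr 3 <;> omega
    · exact (h (by omega)).symm

theorem dwbc_ofEdges_iff {m : ℕ} (hm : m = 2 * n ∨ m + 1 = 2 * n) {ξ : TriEdge → Bool}
    (hξ : ∀ e ∉ gridNetwork.outEdges (squarePoints m),
      ξ e = boundaryBits m (gridNetwork.lineOf e)) :
    (ofEdges m n ξ).DWBC ↔
    (∀ y : ℤ, (m : ℤ) - n ≤ y → y < m → ξ (.horizontal, (0, y)) = false) ∧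
      ∀ x : ℤ, -(n : ℤ) < x → x ≤ 0 → ξ (.vertical, (x, m)) = false := by
  simp only [mem_outEdges_squarePoints hm] at hξ
  constructor
  · intro h
    constructor
    · intro y h1 h2
      have := (h.1 ⟨(m - 1 - y).toNat, by omega⟩).2
      simp only [ofEdges, Fin.val_last] at this
      convert this using 4 <;> omega
    · intro x h1 h2
      have := (h.2 ⟨(x + n - 1).toNat, by omega⟩).1
      simp only [ofEdges, Fin.val_zero] at this
      convert this using 4 <;> omega
  · rintro ⟨hh, hv⟩
    refine ⟨fun i => ⟨?_, ?_⟩, fun j => ⟨?_, ?_⟩⟩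
    · simp only [ofEdges]
      rw [hξ _ (by simp)]
      simp [gridNetwork, LineNetwork.comap, triNetwork, lineThrough, LineType.coord, boundaryBits]
      omega
    · simpa [ofEdges] using hh (m - 1 - i) (by omega) (by omega)
    · simpa [ofEdges] using hv (j - n + 1) (by omega) (by omega)
    · simp only [ofEdges]
      rw [hξ _ (by simp)]
      simp [gridNetwork, LineNetwork.comap, triNetwork, lineThrough, LineType.coord, boundaryBits]
      omega

theorem gridWeight_squarePoint (m : ℕ) (ξ : TriEdge → Bool) (i j : Fin n) :
    gridWeight (ξ ∘ gridNetwork.inEdge (squarePoint m n (i, j)))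
      (ξ ∘ gridNetwork.outEdge (squarePoint m n (i, j))) =
    sixWeight 1 (Real.sqrt 2) 1 ((ofEdges m n ξ).west i j) ((ofEdges m n ξ).south i j)
      ((ofEdges m n ξ).east i j) ((ofEdges m n ξ).north i j) := by
  simp only [gridWeight, gridNetwork, LineNetwork.comap, triNetwork, squarePoint, ofEdges, west,
    east, north, south, Function.comp_apply, Matrix.cons_val_zero, Matrix.cons_val_one,
    Fin.val_succ, Fin.val_castSucc]
  congr 4 <;> push_cast <;> ring

end SquareOrientation

open Classical in
/-- The partition function of the six vertex model as a composition of gates. -/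
theorem partition6VDWBC_eq_gates {m n : ℕ} (hm : m = 2 * n ∨ m + 1 = 2 * n) :
    gates gridWeight gridLines (squarePoints m) (allFalse (triLines m)) (boundaryBits m) =
      partition6VDWBC 1 (Real.sqrt 2) 1 n := by
  have hstart := startsAt_squareStart hm
  have h := LineNetwork.gates_eq_sum gridWeight (allFalse (triLines m))
    (ordered_squarePoints m) hstart (boundaryBits m ∘ gridNetwork.lineOf)
  have hx : (boundaryBits m ∘ gridNetwork.lineOf) ∘ squareStart m n = boundaryBits m := by
    funext k
    simp [hstart.1 k]
  rw [hx, gridNetwork_line] at h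
  rw [h, partition6VDWBC]
  simp only [prod_map_squarePoints hm, SquareOrientation.gridWeight_squarePoint,
    SquareOrientation.prod_sixWeight, allFalse, mul_ite, mul_one, mul_zero]
  simp only [← ite_and]
  rw [← Finset.sum_filter]
  have hmem : ∀ ξ : TriEdge → Bool, ξ ∈ agreeOff (gridNetwork.outEdges (squarePoints m))
      (boundaryBits m ∘ gridNetwork.lineOf) ↔ ∀ e ∉ gridNetwork.outEdges (squarePoints m),
      ξ e = boundaryBits m (gridNetwork.lineOf e) := fun ξ => mem_agreeOff
  refine Finset.sum_bij' (fun ξ _ => SquareOrientation.ofEdges m n ξ) (fun τ _ => τ.toEdges m)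
    (fun ξ hξ => ?_) (fun τ hτ => ?_) (fun ξ hξ => ?_) (fun τ hτ => ?_) (fun ξ hξ => rfl)
  · rw [Finset.mem_filter, hmem] at hξ
    simp only [Finset.mem_filter, Finset.mem_univ, true_and]
    refine ⟨hξ.2.2, ?_⟩
    rw [SquareOrientation.dwbc_ofEdges_iff hm hξ.1, ← forall_triLines_iff hm hξ.1]
    exact hξ.2.1
  · simp only [Finset.mem_filter, Finset.mem_univ, true_and] at hτ
    have h1 := SquareOrientation.toEdges_of_notMem hm hτ.2
    rw [Finset.mem_filter, hmem]
    refine ⟨h1, (forall_triLines_iff hm h1).2 ?_, ?_⟩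
    · rw [← SquareOrientation.dwbc_ofEdges_iff hm h1, SquareOrientation.ofEdges_toEdges]
      exact hτ.2
    · rw [SquareOrientation.ofEdges_toEdges]
      exact hτ.1
  · rw [Finset.mem_filter, hmem] at hξ
    exact SquareOrientation.toEdges_ofEdges hm hξ.1
  · exact SquareOrientation.ofEdges_toEdges m τ

/-! ### The enumeration -/

theorem length_diagonalPoints (x y : ℤ) (k : ℕ) : (diagonalPoints x y k).length = k := by
  induction k generalizing x y with
  | zero => rfl
  | succ k ih => rw [diagonalPoints, List.length_cons, ih]

theorem length_trianglePoints (M : ℤ) (k : ℕ) :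
    2 * (trianglePoints M k).length = k * (k + 1) := by
  induction k with
  | zero => rfl
  | succ k ih =>
    rw [trianglePoints, List.length_append, length_diagonalPoints, mul_add, ih]
    ring

/-- The twenty vertex model on the triangle in terms of the six vertex model on the square. -/
theorem numConfigurations20V3_eq {m n : ℕ} (hm : m = 2 * n ∨ m + 1 = 2 * n) :
    ∃ N : ℕ, 2 * (N + n * n) = m * (m + 1) ∧ (numConfigurations20V3 m : ℝ) =
      Real.sqrt 2 ^ N * partition6VDWBC 1 (Real.sqrt 2) 1 n := by
  refine ⟨((trianglePoints ((m : ℤ) - 1) m).filter fun p =>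
    boundaryBits m (lineThrough p .horizontal) ≠ boundaryBits m (lineThrough p .vertical)).length,
    ?_, ?_⟩
  · rw [← length_squarePoints hm, ← length_trianglePoints ((m : ℤ) - 1) m, squarePoints, add_comm]
    simpa using (List.length_eq_length_filter_add _).symm
  · rw [numConfigurations20V3_eq_gates, gates_twentyWeight_trianglePoints,
      gates_gridWeight_filter (x₀ := boundaryBits m), ← partition6VDWBC_eq_gates hm]
    · rfl
    -- The frozen vertices lie to the left of the square in its rows, or below it in its columns, so
    -- in a common row or column they come before those of the square.
    · refine (pairwise_trianglePoints _ _).imp_of_mem fun {p q} hp hq h => ?_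
      rw [mem_triPoints] at hp hq
      simp only [boundaryBits, lineThrough, LineType.coord, ne_eq, decide_eq_decide]
      omega
    · exact fun _ _ _ _ => rfl
    all_goals simp only [triLines, Set.mem_ofPred_eq, boundaryBits]
    all_goals intros
    all_goals first | trivial | omega

theorem sqrt_two_pow (N : ℕ) : Real.sqrt 2 ^ (2 * N) = 2 ^ N := by
  rw [pow_mul, Real.sq_sqrt (by norm_num)]

theorem mainTheorem2 (n : ℕ) (hn : 1 ≤ n) :
    (numConfigurations20V3 (2 * n) : ℝ) =
        2 ^ (n * (n + 1) / 2) * partition6VDWBC 1 (Real.sqrt 2) 1 n ∧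
      (numConfigurations20V3 (2 * n - 1) : ℝ) =
        2 ^ (n * (n - 1) / 2) * partition6VDWBC 1 (Real.sqrt 2) 1 n := by
  constructor
  · obtain ⟨N, hN, h⟩ := numConfigurations20V3_eq (m := 2 * n) (n := n) (Or.inl rfl)
    obtain ⟨k, hk⟩ := (Nat.even_mul_succ_self n).two_dvd
    -- For `m = 2n` the number of frozen vertices is `n(2n + 1) - n² = n(n + 1) = 2k`.
    have : N = 2 * k := by nlinarith
    rw [h, this, sqrt_two_pow, hk, Nat.mul_div_cancel_left _ two_pos]
  · obtain ⟨N, hN, h⟩ := numConfigurations20V3_eq (m := 2 * n - 1) (n := n) (Or.inr (by omega))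
    obtain ⟨j, rfl⟩ : ∃ j, n = j + 1 := ⟨n - 1, by omega⟩
    obtain ⟨k, hk⟩ := (Nat.even_mul_succ_self j).two_dvd
    rw [show 2 * (j + 1) - 1 = 2 * j + 1 by omega] at hN
    -- For `m = 2n - 1` it is `n(2n - 1) - n² = n(n - 1) = j(j + 1) = 2k`.
    have : N = 2 * k := by nlinarith
    rw [h, this, sqrt_two_pow, Nat.add_sub_cancel, mul_comm (j + 1) j, hk,
      Nat.mul_div_cancel_left _ two_pos]
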